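/- Let $(W,S)$ be a Coxeter system with $W$ finite, let $n=|S|$ be its rank, and let $T=\{wsw^{-1}: s\in S,\ w\in W\}$ be the set of reflections. Let $\ell$ denote the word length on $W$ with respect to $T$, and write $v\le w$ if $\ell(w)=\ell(v)+\ell(v^{-1}w)$ (the absolute order). Let $c\in W$ be a Coxeter element, that is, a conjugate of a product of all the elements of $S$, each occurring once, in some order, and let $\mathrm{NC}(W)=\{w\in W: w\le c\}$, ordered by $\le$. The Hurwitz graph $H(W)$ is the undirected graph whose vertices are the maximal chains of $\mathrm{NC}(W)$, in which two maximal chains are adjacent if and only if they differ in exactly one element (each has exactly one element not contained in the other). For a graph $G$ with distance $d$, let $\mathrm{ecc}(v)=\max_w d(v,w)$, $\mathrm{rad}(G)=\min_v \mathrm{ecc}(v)$ and $\mathrm{diam}(G)=\max_v\mathrm{ecc}(v)$. Then: 1. $\binom n2\le \mathrm{rad}(H(W))$. 2. If $W$ is of type $A_n$, then $\mathrm{rad}(H(W))=\binom n2$. 3. If $W$ is of type $A_3$, then $\mathrm{diam}(H(W))=3$; if $W$ is of type $A_4$, then $\mathrm{diam}(H(W))=7$. 4. If $W$ is of type $B_3$,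 then $\mathrm{rad}(H(W))=\binom32=3$ and $\mathrm{diam}(H(W))=4$. -/

import Mathlib

namespace CoxeterMatrix

/-- The Coxeter matrix `M` is, up to renaming the simple generators, the Coxeter matrix `N`. -/
def HasType {B B' : Type*} (M : CoxeterMatrix B) (N : CoxeterMatrix B') : Prop :=
  ∃ e : B ≃ B', M.reindex e = N

end CoxeterMatrix

namespace CoxeterSystem

/-- A Coxeter element is a conjugate of a product of all simple reflections, each occurring
exactly once, in some order. -/
def IsCoxeterElement {B W : Type*} [Group W] {M : CoxeterMatrix B} (cs : CoxeterSystem M W)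
    (c : W) : Prop :=
  ∃ l : List B, l.Nodup ∧ (∀ i, i ∈ l) ∧ IsConj (cs.wordProd l) c

/-- The word length of `w` with respect to the generating set of all reflections. -/
noncomputable def absLength {B W : Type*} [Group W] {M : CoxeterMatrix B}
    (cs : CoxeterSystem M W) (w : W) : ℕ :=
  sInf {k : ℕ | ∃ l : List W, l.length = k ∧ (∀ t ∈ l, cs.IsReflection t) ∧ l.prod = w}

/-- The absolute order. -/
def AbsLE {B W : Type*} [Group W] {M : CoxeterMatrix B} (cs : CoxeterSystem M W)
    (v w : W) : Prop :=
  cs.absLength w = cs.absLength v + cs.absLength (v⁻¹ * w)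

theorem exists_reflection_word {B W : Type*} [Group W] {M : CoxeterMatrix B}
    (cs : CoxeterSystem M W) (w : W) :
    ∃ l : List W, l.length = cs.absLength w ∧ (∀ t ∈ l, cs.IsReflection t) ∧ l.prod = w := by
  have hne : {k : ℕ | ∃ l : List W, l.length = k ∧ (∀ t ∈ l, cs.IsReflection t) ∧
      l.prod = w}.Nonempty := by
    obtain ⟨ω, rfl⟩ := cs.wordProd_surjective w
    refine ⟨_, ω.map cs.simple, rfl, ?_, rfl⟩
    intro t ht
    obtain ⟨i, -, rfl⟩ := List.mem_map.1 ht
    exact cs.isReflection_simple i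
  exact Nat.sInf_mem hne

theorem absLength_le {B W : Type*} [Group W] {M : CoxeterMatrix B} (cs : CoxeterSystem M W)
    (l : List W) (hl : ∀ t ∈ l, cs.IsReflection t) : cs.absLength l.prod ≤ l.length :=
  Nat.sInf_le ⟨l, rfl, hl, rfl⟩

theorem absLength_one {B W : Type*} [Group W] {M : CoxeterMatrix B} (cs : CoxeterSystem M W) :
    cs.absLength 1 = 0 := by
  simpa using cs.absLength_le [] (by simp)

theorem eq_one_of_absLength_eq_zero {B W : Type*} [Group W] {M : CoxeterMatrix B}
    (cs : CoxeterSystem M W) {w : W} (h : cs.absLength w = 0) : w = 1 := by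
  obtain ⟨l, hl, -, rfl⟩ := cs.exists_reflection_word w
  rw [h, List.length_eq_zero_iff] at hl
  simp [hl]

theorem absLength_mul_le {B W : Type*} [Group W] {M : CoxeterMatrix B}
    (cs : CoxeterSystem M W) (v w : W) :
    cs.absLength (v * w) ≤ cs.absLength v + cs.absLength w := by
  obtain ⟨l, hl, hlr, hlp⟩ := cs.exists_reflection_word v
  obtain ⟨m, hm, hmr, hmp⟩ := cs.exists_reflection_word w
  have h := cs.absLength_le (l ++ m) (by
    intro t ht
    rcases List.mem_append.1 ht with ht | ht
    · exact hlr t ht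
    · exact hmr t ht)
  rwa [List.prod_append, List.length_append, hlp, hmp, hl, hm] at h

/-- The noncrossing partitions of `W` with respect to `c`: the elements of `W` that lie below `c`
in the absolute order (the identity lies below every element). -/
def NC {B W : Type*} [Group W] {M : CoxeterMatrix B} (cs : CoxeterSystem M W) (c : W) : Type _ :=
  {w : W // cs.AbsLE w c}

/-- The noncrossing partitions are partially ordered by the absolute order. -/
instance {B W : Type*} [Group W] {M : CoxeterMatrix B} (cs : CoxeterSystem M W) (c : W) :
    PartialOrder (cs.NC c) where
  le v w := cs.AbsLE v.1 w.1
  le_refl v := by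
    change cs.absLength v.1 = cs.absLength v.1 + cs.absLength (v.1⁻¹ * v.1)
    rw [inv_mul_cancel, absLength_one, Nat.add_zero]
  le_trans u v w huv hvw := by
    change cs.absLength w.1 = cs.absLength u.1 + cs.absLength (u.1⁻¹ * w.1)
    change cs.absLength v.1 = cs.absLength u.1 + cs.absLength (u.1⁻¹ * v.1) at huv
    change cs.absLength w.1 = cs.absLength v.1 + cs.absLength (v.1⁻¹ * w.1) at hvw
    have h1 := cs.absLength_mul_le (u.1⁻¹ * v.1) (v.1⁻¹ * w.1)
    have h2 := cs.absLength_mul_le u.1 (u.1⁻¹ * w.1)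
    rw [mul_assoc, mul_inv_cancel_left] at h1
    rw [mul_inv_cancel_left] at h2
    omega
  le_antisymm v w hvw hwv := by
    change cs.absLength w.1 = cs.absLength v.1 + cs.absLength (v.1⁻¹ * w.1) at hvw
    change cs.absLength v.1 = cs.absLength w.1 + cs.absLength (w.1⁻¹ * v.1) at hwv
    have h := cs.eq_one_of_absLength_eq_zero (w := v.1⁻¹ * w.1) (by omega)
    exact Subtype.ext (inv_mul_eq_one.1 h)

/-- The Hurwitz graph: its vertices are the maximal chains of noncrossing partitions, and two
maximal chains are adjacent if they differ in exactly one element, that is, if each of them has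
exactly one element that is not in the other. -/
def hurwitzGraph {B W : Type*} [Group W] {M : CoxeterMatrix B} (cs : CoxeterSystem M W) (c : W) :
    SimpleGraph (Flag (cs.NC c)) where
  Adj C D := ((C : Set (cs.NC c)) \ (D : Set (cs.NC c))).ncard = 1 ∧
    ((D : Set (cs.NC c)) \ (C : Set (cs.NC c))).ncard = 1
  symm := ⟨fun _ _ h => ⟨h.2, h.1⟩⟩
  loopless := ⟨fun C h => by simp at h⟩

end CoxeterSystem

/-! Taking quotients of consecutive members identifies the maximal chains of $\mathrm{NC}(W)$ with
the factorizations of $c$ into $n$ reflections (`hurwitzGraphIso`). Two chains are adjacent when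
exactly one partial product differs, so distances can be studied on factorizations.

Lower bound. In the geometric representation let $\mathrm{Mov}(w)$ be the image of $w-1$. A Coxeter
element of a finite group fixes no nonzero vector, so $\mathrm{Mov}(c)$ is the whole space. Counting
dimensions then turns a maximal chain into a complete flag of spaces $\mathrm{Mov}(x_i)$. Fix a
chain $l$. The position of any other flag relative to that of $l$ is a permutation, recorded by
`Submodule.pivots`. Changing one member of a chain changes one space of its flag, hence the number
of inversions by at most one (`Finset.card_inversions_le`). Relative to itself $l$ has no
inversions. The chain of products of final segments of $l$ is opposite to $l$, since
$\mathrm{Mov}(x)\cap\mathrm{Mov}(x^{-1}c)=0$, and has all $\binom n2$ inversions. So every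
eccentricity is at least $\binom n2$.

Type $A_n$. Here $W$ is the symmetric group and $c$ a long cycle. From any minimal factorization of
$(p_0\,p_1)\cdots(p_{n-1}\,p_n)$ at most $n-1$ Hurwitz moves leave only the last factor moving
$p_n$; that factor must be $(p_{n-1}\,p_n)$, and induction gives $\binom n2$ moves in all
(`hurwitzReach_adjacentSwaps`). So the factorization into adjacent transpositions is a center.

Small types. The groups of types $A$ and $B_3$ are embedded faithfully into permutation groups by
enumerating cosets along a chain of point stabilizers. The factorizations are then listed, and balls
in the finite graphs are computed with neighborhoods stored as bit masks. -/

/-! ### The geometric representation -/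

namespace CoxeterMatrix

open Polynomial in
-- The product of the two reflections acts as a rotation by $\theta=2\pi/m$. Its powers are given by
-- Chebyshev polynomials at $2\cos\theta$, and $S_k(2\cos\theta)\sin\theta=\sin((k+1)\theta)$ makes
-- the coefficients vanish at the exponent $m$. For $m=2$ this fails because $\sin\theta=0$, but
-- then the reflections commute.
theorem reflection_mul_reflection_pow_eq_one {V : Type*} [AddCommGroup V] [Module ℝ V]
    {x y : V} {f g : Module.Dual ℝ V} (hf : f x = 2) (hg : g y = 2) (m : ℕ) (hm : 2 ≤ m)
    (hfy : f y = -2 * Real.cos (Real.pi / m)) (hgx : g x = -2 * Real.cos (Real.pi / m)) :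
    (Module.reflection hf * Module.reflection hg) ^ m = 1 := by
  rcases hm.eq_or_lt with rfl | hm
  · have h1 : f y = 0 := by simp [hfy]
    have h2 : g x = 0 := by simp [hgx]
    ext z
    simp only [pow_two, LinearEquiv.mul_apply, Module.reflection_apply, map_sub, map_smul, hf, hg,
      h1, h2, LinearEquiv.coe_one, id]
    module
  · set θ : ℝ := 2 * Real.pi / m with hθ
    have hm0 : (0 : ℝ) < m := by exact_mod_cast (by omega : 0 < m)
    have hmθ : m * θ = 2 * Real.pi := by rw [hθ]; field_simp
    have hsin : Real.sin θ ≠ 0 := by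
      apply (Real.sin_pos_of_pos_of_lt_pi _ _).ne'
      · positivity
      · rw [hθ, div_lt_iff₀ hm0]
        have : (2 : ℝ) < m := by exact_mod_cast hm
        nlinarith [Real.pi_pos]
    have ht : 2 * Real.cos θ = f y * g x - 2 := by
      rw [hfy, hgx, hθ, mul_div_assoc, Real.cos_two_mul]; ring
    have hS := fun n : ℤ => Polynomial.Chebyshev.S_two_mul_real_cos θ n
    ext z
    rw [Module.reflection_mul_reflection_pow_apply hf hg m z _ ht]
    -- For $m=2k$ the vanishing factor is $S_{k-1}$, as $k\theta=\pi$; for $m=2k+1$ it is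
    -- $S_k+S_{k-1}$, as $(k+1)\theta=2\pi-k\theta$.
    obtain ⟨k, hk | hk⟩ := Nat.even_or_odd' m
    · have hz : (Chebyshev.S ℝ ((k : ℤ) - 1)).eval (2 * Real.cos θ) = 0 := by
        apply mul_right_cancel₀ hsin
        rw [hS, zero_mul]
        have : ((((k : ℤ) - 1 : ℤ) : ℝ) + 1) * θ = Real.pi := by
          rw [hk] at hmθ; push_cast at hmθ ⊢; linarith
        rw [this, Real.sin_pi]
      have e1 : ((m : ℤ) - 2) / 2 = k - 1 := by omega
      have e2 : ((m : ℤ) - 1) / 2 = k - 1 := by omega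
      rw [e1, e2, hz]
      simp
    · have hz : (Chebyshev.S ℝ (k : ℤ)).eval (2 * Real.cos θ) +
          (Chebyshev.S ℝ ((k : ℤ) - 1)).eval (2 * Real.cos θ) = 0 := by
        apply mul_right_cancel₀ hsin
        rw [add_mul, hS, hS, zero_mul]
        have : (((k : ℤ) : ℝ) + 1) * θ = 2 * Real.pi - (((k : ℤ) - 1 : ℤ) + 1 : ℝ) * θ := by
          rw [hk] at hmθ; push_cast at hmθ ⊢; linarith
        rw [this, Real.sin_two_pi_sub]; ring
      have e1 : ((m : ℤ) - 2) / 2 = k - 1 := by omega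
      have e2 : ((m : ℤ) - 1) / 2 = k := by omega
      have e3 : ((m : ℤ) - 3) / 2 = k - 1 := by omega
      have e4 : (m : ℤ) / 2 = k := by omega
      rw [e1, e2, e3, e4, hz]
      simp

variable {B : Type*} [Fintype B] [DecidableEq B] (M : CoxeterMatrix B)

/-- The simple coroot of index `i`, as a linear form on the space spanned by the simple roots. -/
noncomputable def simpleCoroot (i : B) : Module.Dual ℝ (B → ℝ) :=
  ∑ j, (-2 * Real.cos (Real.pi / M i j)) • LinearMap.proj j

theorem simpleCoroot_single (i j : B) :
    M.simpleCoroot i (Pi.single j 1) = -2 * Real.cos (Real.pi / M i j) := by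
  simp [simpleCoroot, LinearMap.sum_apply, Pi.single_apply]

theorem simpleCoroot_self (i : B) : M.simpleCoroot i (Pi.single i 1) = 2 := by
  simp [simpleCoroot_single]

theorem isLiftable_reflection :
    M.IsLiftable fun i => Module.reflection (M.simpleCoroot_self i) := by
  intro i j
  rcases eq_or_ne i j with rfl | hij
  · rw [M.diagonal, pow_one]
    ext1 z
    exact Module.involutive_reflection _ z
  -- The entry $0$ stands for infinite order and imposes no relation.
  · by_cases h0 : M i j = 0
    · rw [h0, pow_zero]
    · have h1 := M.off_diagonal i j hij
      refine reflection_mul_reflection_pow_eq_one _ _ _ (by omega) (M.simpleCoroot_single i j) ?_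
      rw [M.simpleCoroot_single, M.symmetric]

end CoxeterMatrix

/-- If each `g ∈ l` moves vectors only along the line of a root and these roots are linearly
independent, then a vector fixed by the product of `l` is fixed by every member of `l`. -/
theorem LinearIndependent.apply_eq_self_of_prod_apply_eq_self {ι R V : Type*} [Ring R]
    [AddCommGroup V] [Module R V] {α : ι → V} (hα : LinearIndependent R α)
    {s : ι → V →ₗ[R] V} (hs : ∀ i v, s i v - v ∈ Submodule.span R {α i})
    (l : List ι) (hl : l.Nodup) {v : V} (hv : (l.map s).prod v = v) :
    ∀ i ∈ l, s i v = v := by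
  -- A product displaces every vector within the span of the roots of its factors.
  have key : ∀ (l : List ι) (v : V),
      (l.map s).prod v - v ∈ Submodule.span R (α '' {i | i ∈ l}) := by
    intro l
    induction l with
    | nil => intro v; simp
    | cons i l ih =>
      intro v
      have h1 := hs i ((l.map s).prod v)
      have h2 : Submodule.span R {α i} ≤ Submodule.span R (α '' {j | j ∈ i :: l}) := by
        apply Submodule.span_mono; simp
      have h3 : Submodule.span R (α '' {j | j ∈ l}) ≤
          Submodule.span R (α '' {j | j ∈ i :: l}) := by
        apply Submodule.span_mono; apply Set.image_mono
        intro j hj; exact List.mem_cons_of_mem _ hj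
      have := add_mem (h2 h1) (h3 (ih v))
      rw [List.map_cons, List.prod_cons, Module.End.mul_apply]
      simpa using this
  induction l with
  | nil => simp
  | cons i l ih =>
    rw [List.nodup_cons] at hl
    rw [List.map_cons, List.prod_cons, Module.End.mul_apply] at hv
    have h1 := hs i ((l.map s).prod v)
    rw [hv] at h1
    have h2 := key l v
    -- The displacements by the first factor and by the rest cancel and lie in complementary spans,
    -- so both vanish.
    have hd : Disjoint (Submodule.span R (α '' {i})) (Submodule.span R (α '' {j | j ∈ l})) := by
      apply hα.disjoint_span_image
      simpa using hl.1
    rw [Set.image_singleton] at hd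
    have h3 : (l.map s).prod v - v = 0 := by
      apply Submodule.disjoint_def.1 hd _ _ h2
      rw [← neg_sub]
      exact neg_mem h1
    rw [sub_eq_zero] at h3
    rw [h3] at hv
    intro j hj
    rcases List.mem_cons.1 hj with rfl | hj
    · exact hv
    · exact ih hl.2 h3 j hj

namespace CoxeterSystem

variable {B W : Type*} [Group W] {M : CoxeterMatrix B} (cs : CoxeterSystem M W)

section GeometricRepresentation

variable [Fintype B] [DecidableEq B]

/-- The geometric representation of a Coxeter group. -/
noncomputable def geoRep : W →* ((B → ℝ) →ₗ[ℝ] (B → ℝ)) :=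
  (LinearEquiv.automorphismGroup.toLinearMapMonoidHom).comp (cs.lift ⟨_, M.isLiftable_reflection⟩)

theorem geoRep_simple (i : B) (v : B → ℝ) :
    cs.geoRep (cs.simple i) v = v - M.simpleCoroot i v • Pi.single i 1 := by
  rw [geoRep, MonoidHom.comp_apply, lift_apply_simple]
  exact Module.reflection_apply v (M.simpleCoroot_self i)

/-- No nonzero vector is fixed by a finite Coxeter group. -/
theorem eq_zero_of_forall_geoRep_eq [Finite W] {v : B → ℝ}
    (hv : ∀ i, cs.geoRep (cs.simple i) v = v) : v = 0 := by
  have := Fintype.ofFinite W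
  have hW : ∀ w, cs.geoRep w v = v := by
    intro w
    induction w using cs.simple_induction_left with
    | one => simp
    | mul_simple_left w i ih => rw [map_mul, Module.End.mul_apply, ih, hv]
  -- Replacing $w$ by $ws_i$ changes the sign of each $w(\alpha_i)$, so the sum over the group kills
  -- every simple root. On a fixed vector it is multiplication by $|W|$.
  have hP : (∑ w, cs.geoRep w) = 0 := by
    apply (Pi.basisFun ℝ B).ext
    intro i
    have h1 : (∑ w, cs.geoRep w) (Pi.single i 1) =
        -(∑ w, cs.geoRep w) (Pi.single i 1) := by
      conv_lhs => rw [← Equiv.sum_comp (Equiv.mulRight (cs.simple i))]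
      simp only [Equiv.coe_mulRight, map_mul, LinearMap.sum_apply, Module.End.mul_apply,
        geoRep_simple, M.simpleCoroot_self]
      rw [← Finset.sum_neg_distrib]
      refine Finset.sum_congr rfl fun w _ => ?_
      rw [← map_neg]
      congr 1
      module
    simpa [self_eq_neg] using h1
  have h := congrArg (fun f => f v) hP
  simp only [LinearMap.sum_apply, hW, Finset.sum_const, LinearMap.zero_apply] at h
  rw [← Nat.cast_smul_eq_nsmul ℝ] at h
  exact (smul_eq_zero.1 h).resolve_left (by simp [Fintype.card_ne_zero])

theorem finrank_range_geoRep_sub_one_le {t : W} (ht : cs.IsReflection t) :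
    Module.finrank ℝ (LinearMap.range (cs.geoRep t - 1)) ≤ 1 := by
  obtain ⟨w, i, rfl⟩ := ht
  have : LinearMap.range (cs.geoRep (w * cs.simple i * w⁻¹) - 1) ≤
      Submodule.span ℝ {cs.geoRep w (Pi.single i 1)} := by
    rintro _ ⟨v, rfl⟩
    rw [Submodule.mem_span_singleton]
    refine ⟨-M.simpleCoroot i (cs.geoRep w⁻¹ v), ?_⟩
    have hwv : cs.geoRep w (cs.geoRep w⁻¹ v) = v := by
      rw [← Module.End.mul_apply, ← map_mul]; simp
    simp only [map_mul, LinearMap.sub_apply, Module.End.mul_apply, geoRep_simple, map_sub,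
      map_smul, hwv, Module.End.one_apply]
    module
  exact (Submodule.finrank_mono this).trans ((finrank_span_le_card _).trans (by simp))

/-- The space of the vectors `w v - v`. -/
noncomputable def moved (w : W) : Submodule ℝ (B → ℝ) := LinearMap.range (cs.geoRep w - 1)

theorem moved_mul_le (v w : W) : cs.moved (v * w) ≤ cs.moved v ⊔ cs.moved w := by
  rintro _ ⟨x, rfl⟩
  have : (cs.geoRep (v * w) - 1) x =
      (cs.geoRep v - 1) (cs.geoRep w x) + (cs.geoRep w - 1) x := by
    simp [map_mul]
  rw [this]
  exact Submodule.add_mem_sup ⟨_, rfl⟩ ⟨_, rfl⟩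

/-- A reflection displaces along a line and displacement spaces are subadditive. This is the half of
Carter's lemma that holds without any further hypothesis; equality below $c$ comes from counting
dimensions. -/
theorem finrank_moved_le (w : W) : Module.finrank ℝ (cs.moved w) ≤ cs.absLength w := by
  obtain ⟨l, hl, hr, rfl⟩ := cs.exists_reflection_word w
  rw [← hl]
  clear hl
  induction l with
  | nil => rw [moved, List.prod_nil, map_one, sub_self, LinearMap.range_zero, finrank_bot]; simp
  | cons t l ih =>
    rw [List.prod_cons, List.length_cons]
    have h1 := Submodule.finrank_mono (cs.moved_mul_le t l.prod)
    have h2 := Submodule.finrank_add_le_finrank_add_finrank (cs.moved t) (cs.moved l.prod)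
    have h3 := cs.finrank_range_geoRep_sub_one_le (hr t (by simp))
    have h4 := ih fun t ht => hr t (by simp [ht])
    change Module.finrank ℝ (cs.moved t) ≤ 1 at h3
    omega

/-- A vector fixed by a product of all simple reflections is fixed by each of them, hence by $W$,
hence zero. So $c-1$ is injective and, in finite dimension, surjective. -/
theorem moved_eq_top [Finite W] {c : W} (hc : cs.IsCoxeterElement c) : cs.moved c = ⊤ := by
  obtain ⟨l, hl, hmem, hconj⟩ := hc
  have h1 : ∀ v, cs.geoRep (cs.wordProd l) v = v → v = 0 := by
    intro v hv
    apply cs.eq_zero_of_forall_geoRep_eq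
    have := LinearIndependent.apply_eq_self_of_prod_apply_eq_self
      (Pi.basisFun ℝ B).linearIndependent (s := fun i => cs.geoRep (cs.simple i)) (v := v) ?_ l hl ?_
    · exact fun i => this i (hmem i)
    · intro i v
      rw [Submodule.mem_span_singleton]
      refine ⟨-M.simpleCoroot i v, ?_⟩
      simp only [geoRep_simple, Pi.basisFun_apply]
      module
    · rw [wordProd, map_list_prod, List.map_map] at hv
      exact hv
  obtain ⟨g, rfl⟩ := isConj_iff.1 hconj
  rw [moved, LinearMap.range_eq_top, ← LinearMap.injective_iff_surjective,
    injective_iff_map_eq_zero]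
  intro v hv
  rw [LinearMap.sub_apply, sub_eq_zero, map_mul, map_mul, Module.End.mul_apply,
    Module.End.mul_apply, Module.End.one_apply] at hv
  have h2 := h1 (cs.geoRep g⁻¹ v) (by
    have := congrArg (cs.geoRep g⁻¹) hv
    rwa [← Module.End.mul_apply, ← map_mul, inv_mul_cancel, map_one, Module.End.one_apply] at this)
  have := congrArg (cs.geoRep g) h2
  rwa [← Module.End.mul_apply, ← map_mul, mul_inv_cancel, map_one, Module.End.one_apply,
    map_zero] at this

end GeometricRepresentation

theorem absLength_mul_eq_of_isConj {v w : W} (h : IsConj v w) :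
    cs.absLength v = cs.absLength w := by
  have key : ∀ g v : W, cs.absLength (g * v * g⁻¹) ≤ cs.absLength v := by
    intro g v
    obtain ⟨l, hl, hr, rfl⟩ := cs.exists_reflection_word v
    have := cs.absLength_le (l.map (MulAut.conj g)) (by
      simp only [List.mem_map, forall_exists_index, and_imp, forall_apply_eq_imp_iff₂]
      intro t ht
      rw [MulAut.conj_apply, isReflection_conj_iff]
      exact hr t ht)
    rw [← map_list_prod, List.length_map, hl, MulAut.conj_apply] at this
    exact this
  obtain ⟨g, rfl⟩ := isConj_iff.1 h
  apply le_antisymm _ (key g v)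
  simpa [mul_assoc] using key g⁻¹ (g * v * g⁻¹)

/-- The defining word gives the upper bound; the lower bound is the dimension of $\mathrm{Mov}(c)$.
-/
theorem absLength_coxeterElement [Fintype B] [Finite W] {c : W} (hc : cs.IsCoxeterElement c) :
    cs.absLength c = Fintype.card B := by
  classical
  apply le_antisymm
  · obtain ⟨l, hl, hmem, hconj⟩ := hc
    rw [← cs.absLength_mul_eq_of_isConj hconj]
    have := cs.absLength_le (l.map cs.simple) (by
      simp only [List.mem_map, forall_exists_index, and_imp, forall_apply_eq_imp_iff₂]
      exact fun i _ => cs.isReflection_simple i)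
    rw [List.length_map] at this
    exact this.trans hl.length_le_card
  · have := cs.finrank_moved_le c
    rw [cs.moved_eq_top hc] at this
    simpa using this

end CoxeterSystem

/-! ### Maximal chains and reflection factorizations -/

/-- The factorizations of `c` into `n` elements of `R`. -/
abbrev Factorization {G : Type*} [Group G] (R : Set G) (n : ℕ) (c : G) : Type _ :=
  {l : List G // l.length = n ∧ (∀ t ∈ l, t ∈ R) ∧ l.prod = c}

/-- Two factorizations are adjacent if exactly one of their partial products differs. -/
def factorizationGraph {G : Type*} [Group G] (R : Set G) (n : ℕ) (c : G) :
    SimpleGraph (Factorization R n c) where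
  -- Indices $i\ge n$ never count: both products are then $c$.
  Adj l m := ∃! i : ℕ, (l.1.take i).prod ≠ (m.1.take i).prod
  symm := ⟨fun _ _ h => by simpa only [ne_comm] using h⟩
  loopless := ⟨fun _ h => by simp [ExistsUnique] at h⟩

theorem List.eq_of_forall_prod_take_eq {G : Type*} [Group G] {l m : List G}
    (hlen : l.length = m.length) (h : ∀ i, (l.take i).prod = (m.take i).prod) : l = m := by
  apply List.ext_getElem hlen
  intro i hi hi'
  have h1 := h (i + 1)
  rwa [List.prod_take_succ _ _ hi, List.prod_take_succ _ _ hi', h i, mul_left_cancel_iff] at h1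

theorem List.prod_take_inv_mul_prod_take {G : Type*} [Group G] (l : List G) {i j : ℕ}
    (hij : i ≤ j) : (l.take i).prod⁻¹ * (l.take j).prod = ((l.take j).drop i).prod := by
  have := List.take_append_drop i (l.take j)
  rw [List.take_take, min_eq_left hij] at this
  nth_rw 1 [← this]
  rw [List.prod_append, inv_mul_cancel_left]

namespace CoxeterSystem

variable {B W : Type*} [Group W] {M : CoxeterMatrix B} (cs : CoxeterSystem M W)

/-- Subadditivity: a shorter expression of the middle part would shorten the whole word. -/
theorem absLength_prod_of_append {a b d : List W}
    (hr : ∀ t ∈ a ++ b ++ d, cs.IsReflection t)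
    (h : cs.absLength (a ++ b ++ d).prod = (a ++ b ++ d).length) :
    cs.absLength b.prod = b.length := by
  have ha := cs.absLength_le a fun t ht => hr t (by simp [ht])
  have hb := cs.absLength_le b fun t ht => hr t (by simp [ht])
  have hd := cs.absLength_le d fun t ht => hr t (by simp [ht])
  have h1 := cs.absLength_mul_le (a.prod * b.prod) d.prod
  have h2 := cs.absLength_mul_le a.prod b.prod
  simp only [List.prod_append, List.length_append] at h
  omega

theorem absLength_prod_drop_take {l : List W} (hr : ∀ t ∈ l, cs.IsReflection t)
    (h : cs.absLength l.prod = l.length) (i j : ℕ) :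
    cs.absLength ((l.take j).drop i).prod = ((l.take j).drop i).length := by
  have e : (l.take j).take i ++ (l.take j).drop i ++ l.drop j = l := by simp
  apply cs.absLength_prod_of_append (a := (l.take j).take i) (d := l.drop j)
  · rwa [e]
  · rwa [e]

theorem absLength_prod_take {l : List W} (hr : ∀ t ∈ l, cs.IsReflection t)
    (h : cs.absLength l.prod = l.length) (i : ℕ) :
    cs.absLength (l.take i).prod = min i l.length := by
  simpa using cs.absLength_prod_drop_take hr h 0 i

theorem absLE_prod_take {l : List W} (hr : ∀ t ∈ l, cs.IsReflection t)
    (h : cs.absLength l.prod = l.length) {i j : ℕ} (hij : i ≤ j) :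
    cs.AbsLE (l.take i).prod (l.take j).prod := by
  rw [AbsLE, l.prod_take_inv_mul_prod_take hij, cs.absLength_prod_drop_take hr h,
    cs.absLength_prod_take hr h, cs.absLength_prod_take hr h]
  simp
  omega

theorem absLE_prod_take_prod {l : List W} (hr : ∀ t ∈ l, cs.IsReflection t)
    (h : cs.absLength l.prod = l.length) (i : ℕ) :
    cs.AbsLE (l.take i).prod l.prod := by
  rcases le_total i l.length with hi | hi
  · simpa using cs.absLE_prod_take hr h hi
  · simpa [List.take_of_length_le hi] using cs.absLE_prod_take hr h (le_refl i)

variable {cs} {c : W}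

theorem NC.eq_of_le_of_absLength_eq {x y : cs.NC c} (h : x ≤ y)
    (hr : cs.absLength x.1 = cs.absLength y.1) : x = y := by
  change cs.absLength y.1 = cs.absLength x.1 + cs.absLength (x.1⁻¹ * y.1) at h
  exact Subtype.ext (inv_mul_eq_one.1 (cs.eq_one_of_absLength_eq_zero (by omega)))

theorem NC.absLength_le_of_le {x y : cs.NC c} (h : x ≤ y) :
    cs.absLength x.1 ≤ cs.absLength y.1 := by
  change cs.absLength y.1 = cs.absLength x.1 + cs.absLength (x.1⁻¹ * y.1) at h
  omega

theorem NC.absLength_le (x : cs.NC c) : cs.absLength x.1 ≤ cs.absLength c := by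
  have h : cs.absLength c = cs.absLength x.1 + cs.absLength (x.1⁻¹ * c) := x.2
  omega

theorem NC.eq_of_isChain {s : Set (cs.NC c)} (hs : IsChain (· ≤ ·) s) {x y : cs.NC c}
    (hx : x ∈ s) (hy : y ∈ s) (h : cs.absLength x.1 = cs.absLength y.1) : x = y := by
  rcases hs.total hx hy with h' | h'
  · exact NC.eq_of_le_of_absLength_eq h' h
  · exact (NC.eq_of_le_of_absLength_eq h' h.symm).symm

theorem NC.le_of_isChain {s : Set (cs.NC c)} (hs : IsChain (· ≤ ·) s) {x y : cs.NC c}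
    (hx : x ∈ s) (hy : y ∈ s) (h : cs.absLength x.1 ≤ cs.absLength y.1) : x ≤ y := by
  rcases hs.total hx hy with h' | h'
  · exact h'
  · exact (NC.eq_of_le_of_absLength_eq h' (le_antisymm (NC.absLength_le_of_le h') h)).symm.le

/-- The chain of the partial products of a factorization of minimal length. -/
def Factorization.toFlag {n : ℕ} (hn : cs.absLength c = n)
    (l : Factorization {t | cs.IsReflection t} n c) : Flag (cs.NC c) where
  carrier := {x | ∃ i, (l.1.take i).prod = x.1}
  Chain' := by
    obtain ⟨l, hlen, hr, rfl⟩ := l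
    rintro x ⟨i, hi⟩ y ⟨j, hj⟩ -
    rw [← hlen] at hn
    rcases le_total i j with h | h
    · left
      change cs.AbsLE x.1 y.1
      rw [← hi, ← hj]
      exact cs.absLE_prod_take hr hn h
    · right
      change cs.AbsLE y.1 x.1
      rw [← hi, ← hj]
      exact cs.absLE_prod_take hr hn h
  max_chain' := by
    obtain ⟨l, hlen, hr, rfl⟩ := l
    rw [← hlen] at hn
    intro s hs hls
    apply hls.antisymm
    intro x hx
    have hle := cs.absLE_prod_take_prod hr hn (cs.absLength x.1)
    -- A chain has at most one member of each length, and the partial products already occupy every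
    -- length.
    have := NC.eq_of_isChain hs hx (hls ⟨cs.absLength x.1, rfl⟩ : ⟨_, hle⟩ ∈ s) (by
      dsimp only
      rw [cs.absLength_prod_take hr hn, min_eq_left]
      exact hn ▸ NC.absLength_le x)
    exact ⟨cs.absLength x.1, (congrArg Subtype.val this).symm⟩

theorem Factorization.mem_toFlag {n : ℕ} {hn : cs.absLength c = n}
    {l : Factorization {t | cs.IsReflection t} n c} {x : cs.NC c} :
    x ∈ (Factorization.toFlag hn l : Set (cs.NC c)) ↔ ∃ i, (l.1.take i).prod = x.1 := Iff.rfl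

theorem Factorization.absLength_prod_take {n : ℕ} (hn : cs.absLength c = n)
    (l : Factorization {t | cs.IsReflection t} n c) (i : ℕ) :
    cs.absLength (l.1.take i).prod = min i n := by
  obtain ⟨l, hlen, hr, rfl⟩ := l
  rw [← hlen] at hn
  rw [cs.absLength_prod_take hr hn, hlen]

theorem Factorization.absLE_prod_take {n : ℕ} (hn : cs.absLength c = n)
    (l : Factorization {t | cs.IsReflection t} n c) (i : ℕ) :
    cs.AbsLE (l.1.take i).prod c := by
  obtain ⟨l, hlen, hr, rfl⟩ := l
  rw [← hlen] at hn
  exact cs.absLE_prod_take_prod hr hn i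

theorem Factorization.prod_take_of_le {G : Type*} [Group G] {R : Set G} {c : G} {n : ℕ}
    (l : Factorization R n c) {i : ℕ} (h : n ≤ i) : (l.1.take i).prod = c := by
  rw [List.take_of_length_le (l.2.1.trans_le h), l.2.2.2]

/-- The length of a partial product determines its index up to $n$. Hence membership in another
chain can be tested at the same index. -/
theorem Factorization.prod_take_eq_of_mem_toFlag {n : ℕ} {hn : cs.absLength c = n}
    {l m : Factorization {t | cs.IsReflection t} n c} {i j : ℕ}
    (h : (l.1.take i).prod = (m.1.take j).prod) : (l.1.take i).prod = (m.1.take i).prod := by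
  have h1 := congrArg cs.absLength h
  rw [absLength_prod_take hn, absLength_prod_take hn] at h1
  rcases lt_or_ge i n with hi | hi
  · rw [h]
    congr 2
    omega
  · rw [prod_take_of_le l hi, prod_take_of_le m hi]

theorem Factorization.ncard_toFlag_sdiff {n : ℕ} {hn : cs.absLength c = n}
    (l m : Factorization {t | cs.IsReflection t} n c) :
    ((toFlag hn l : Set (cs.NC c)) \ (toFlag hn m : Set (cs.NC c))).ncard =
      {i : ℕ | (l.1.take i).prod ≠ (m.1.take i).prod}.ncard := by
  have : (toFlag hn l : Set (cs.NC c)) \ (toFlag hn m : Set (cs.NC c)) =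
      (fun i : ℕ => (⟨(l.1.take i).prod, absLE_prod_take hn l i⟩ : cs.NC c)) ''
        {i : ℕ | (l.1.take i).prod ≠ (m.1.take i).prod} := by
    ext x
    simp only [Set.mem_sdiff, mem_toFlag, Set.mem_ofPred_eq]
    constructor
    · rintro ⟨⟨i, hi⟩, h⟩
      exact ⟨i, fun h' => h ⟨i, h'.symm.trans hi⟩, Subtype.ext hi⟩
    · rintro ⟨i, hi, rfl⟩
      refine ⟨⟨i, rfl⟩, ?_⟩
      rintro ⟨j, hj⟩
      exact hi (prod_take_eq_of_mem_toFlag (hn := hn) hj.symm)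
  rw [this]
  apply Set.InjOn.ncard_image
  intro i hi j hj hij
  have h1 : (l.1.take i).prod = (l.1.take j).prod := congrArg Subtype.val hij
  have h2 := congrArg cs.absLength h1
  rw [absLength_prod_take hn, absLength_prod_take hn] at h2
  have hi' : i < n := by
    by_contra h
    push Not at h
    exact hi (by rw [prod_take_of_le l h, prod_take_of_le m h])
  have hj' : j < n := by
    by_contra h
    push Not at h
    exact hj (by rw [prod_take_of_le l h, prod_take_of_le m h])
  omega

theorem Factorization.toFlag_injective {n : ℕ} (hn : cs.absLength c = n) :
    Function.Injective (toFlag (cs := cs) (c := c) hn) := by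
  intro l m h
  apply Subtype.ext
  apply List.eq_of_forall_prod_take_eq (l.2.1.trans m.2.1.symm)
  intro i
  have : (⟨(l.1.take i).prod, absLE_prod_take hn l i⟩ : cs.NC c) ∈
      (toFlag hn m : Set (cs.NC c)) := by
    rw [← h]; exact ⟨i, rfl⟩
  obtain ⟨j, hj⟩ := this
  exact prod_take_eq_of_mem_toFlag (hn := hn) hj.symm

/-- Between two noncrossing partitions whose ranks differ by at least two there is a third. -/
theorem NC.exists_between {x y : cs.NC c} (h : x ≤ y)
    (hr : cs.absLength x.1 + 2 ≤ cs.absLength y.1) :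
    ∃ z : cs.NC c, x ≤ z ∧ z ≤ y ∧ cs.absLength z.1 = cs.absLength x.1 + 1 := by
  have hxy : cs.absLength y.1 = cs.absLength x.1 + cs.absLength (x.1⁻¹ * y.1) := h
  have hyc : cs.absLength c = cs.absLength y.1 + cs.absLength (y.1⁻¹ * c) := y.2
  obtain ⟨l, hl, hlr, hlp⟩ := cs.exists_reflection_word (x.1⁻¹ * y.1)
  match l, hl with
  | [], hl => simp at hl; omega
  | t :: l, hl =>
    rw [List.length_cons] at hl
    rw [List.prod_cons] at hlp
    have ht := cs.absLength_le [t] (fun s hs => hlr s (by simp_all))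
    have hl' := cs.absLength_le l (fun s hs => hlr s (by simp_all))
    rw [List.prod_singleton, List.length_singleton] at ht
    -- The intermediate element is $xt$, with $t$ the first letter of a shortest word for $x^{-1}y$.
    have hy : y.1 = x.1 * t * l.prod := by rw [mul_assoc, hlp, mul_inv_cancel_left]
    have h1 := cs.absLength_mul_le (x.1 * t) l.prod
    have h2 := cs.absLength_mul_le x.1 t
    have h3 := cs.absLength_mul_le t l.prod
    have h4 := cs.absLength_mul_le (x.1 * t) ((x.1 * t)⁻¹ * c)
    have h5 := cs.absLength_mul_le l.prod (y.1⁻¹ * c)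
    have e5 : l.prod * (y.1⁻¹ * c) = (x.1 * t)⁻¹ * c := by rw [hy]; group
    rw [e5] at h5
    rw [mul_inv_cancel_left] at h4
    rw [← hy] at h1
    refine ⟨⟨x.1 * t, ?_⟩, ?_, ?_, ?_⟩
    · change cs.absLength c = cs.absLength (x.1 * t) + cs.absLength ((x.1 * t)⁻¹ * c)
      omega
    · change cs.absLength (x.1 * t) = cs.absLength x.1 + cs.absLength (x.1⁻¹ * (x.1 * t))
      rw [inv_mul_cancel_left]
      omega
    · change cs.absLength y.1 = cs.absLength (x.1 * t) + cs.absLength ((x.1 * t)⁻¹ * y.1)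
      rw [show (x.1 * t)⁻¹ * y.1 = l.prod by rw [hy]; group]
      omega
    · change cs.absLength (x.1 * t) = _
      omega

/-- If a rank were skipped, `NC.exists_between` would supply an element of that rank comparable with
all of $C$, and maximality would put it into $C$. -/
theorem NC.exists_mem_flag (C : Flag (cs.NC c)) {i : ℕ} (hi : i ≤ cs.absLength c) :
    ∃ x ∈ C, cs.absLength x.1 = i := by
  have hone : cs.AbsLE 1 c := by simp [AbsLE, cs.absLength_one]
  have hcc : cs.AbsLE c c := by simp [AbsLE, cs.absLength_one]
  have hbot : (⟨1, hone⟩ : cs.NC c) ∈ C := C.mem_iff_forall_le_or_ge.2 fun b _ => Or.inl (by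
    change cs.AbsLE 1 b.1; simp [AbsLE, cs.absLength_one])
  have htop : (⟨c, hcc⟩ : cs.NC c) ∈ C := C.mem_iff_forall_le_or_ge.2 fun b _ => Or.inr b.2
  induction i with
  | zero => exact ⟨_, hbot, cs.absLength_one⟩
  | succ i ih =>
    obtain ⟨x, hx, hxi⟩ := ih (by omega)
    by_contra hne
    push Not at hne
    -- Select the member $y$ of least rank above $i$; the missing element is inserted between $x$
    -- and $y$.
    have hex : ∃ k, ∃ y ∈ C, i < cs.absLength y.1 ∧ cs.absLength y.1 = k :=
      ⟨_, _, htop, hi, rfl⟩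
    classical
    obtain ⟨y, hy, hiy, hyk⟩ := Nat.find_spec hex
    have hmin : ∀ z ∈ C, i < cs.absLength z.1 → cs.absLength y.1 ≤ cs.absLength z.1 := by
      intro z hz hiz
      rw [hyk]
      exact Nat.find_min' hex ⟨z, hz, hiz, rfl⟩
    have hy' := hne y hy
    have hxy : x ≤ y := NC.le_of_isChain C.Chain' hx hy (by omega)
    obtain ⟨z, hxz, hzy, hz⟩ := NC.exists_between hxy (by omega)
    refine hne z ?_ (by omega)
    refine C.mem_iff_forall_le_or_ge.2 fun b hb => ?_
    rcases le_or_gt (cs.absLength b.1) i with h | h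
    · exact Or.inr ((NC.le_of_isChain C.Chain' hb hx (by omega)).trans hxz)
    · exact Or.inl (hzy.trans (NC.le_of_isChain C.Chain' hy hb (hmin b hb h)))

theorem isReflection_of_absLength_eq_one {w : W} (h : cs.absLength w = 1) :
    cs.IsReflection w := by
  obtain ⟨l, hl, hr, rfl⟩ := cs.exists_reflection_word w
  rw [h, List.length_eq_one_iff] at hl
  obtain ⟨t, rfl⟩ := hl
  simpa using hr

theorem _root_.List.prod_take_ofFn_inv_mul {G : Type*} [Group G] (x : ℕ → G) (n i : ℕ)
    (hi : i ≤ n) :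
    ((List.ofFn fun k : Fin n => (x k)⁻¹ * x (k + 1)).take i).prod = (x 0)⁻¹ * x i := by
  induction i with
  | zero => simp
  | succ i ih =>
    rw [List.prod_take_succ _ _ (by simpa using hi), ih (by omega)]
    simp [mul_assoc]

/-- A flag has one member in each rank; consecutive members have quotients of length one, that is,
reflections, whose product telescopes to $c$. -/
theorem Factorization.toFlag_surjective {n : ℕ} (hn : cs.absLength c = n) :
    Function.Surjective (toFlag (cs := cs) (c := c) hn) := by
  intro C
  have hex : ∀ i : ℕ, ∃ x ∈ C, cs.absLength x.1 = min i n := fun i =>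
    NC.exists_mem_flag C (by omega)
  choose x hxC hx using hex
  have hx0 : (x 0).1 = 1 := cs.eq_one_of_absLength_eq_zero (by rw [hx]; simp)
  have hxn : (x n).1 = c := by
    have h : cs.absLength c = cs.absLength (x n).1 + cs.absLength ((x n).1⁻¹ * c) := (x n).2
    rw [hx, hn, min_self] at h
    exact inv_mul_eq_one.1 (cs.eq_one_of_absLength_eq_zero (by omega))
  have htake := fun i hi => List.prod_take_ofFn_inv_mul (fun k => (x k).1) n i hi
  simp only [hx0, inv_one, one_mul] at htake
  refine ⟨⟨List.ofFn fun k : Fin n => (x k).1⁻¹ * (x (k + 1)).1, by simp, ?_, ?_⟩, ?_⟩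
  · intro t ht
    obtain ⟨k, rfl⟩ := (List.mem_ofFn' _ _).1 ht
    have hle : x k ≤ x (k + 1) := NC.le_of_isChain C.Chain' (hxC _) (hxC _) (by
      rw [hx, hx]; omega)
    change cs.absLength (x (k + 1)).1 = cs.absLength (x k).1 +
      cs.absLength ((x k).1⁻¹ * (x (k + 1)).1) at hle
    have hk := k.2
    have hk1 := hx k
    have hk2 := hx (k + 1)
    have : cs.absLength ((x k).1⁻¹ * (x (k + 1)).1) = 1 := by omega
    exact isReflection_of_absLength_eq_one this
  · have := htake n le_rfl
    rwa [List.take_of_length_le (by simp), hxn] at this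
  · symm
    apply SetLike.coe_injective
    apply C.max_chain' (Flag.Chain' _)
    intro y hy
    have h := NC.absLength_le y
    refine ⟨cs.absLength y.1, ?_⟩
    dsimp only
    rw [htake _ (hn ▸ h)]
    exact congrArg Subtype.val (NC.eq_of_isChain C.Chain' (hxC _) hy (by rw [hx]; omega))

variable (cs) in
/-- The Hurwitz graph is the graph of the shortest reflection factorizations. -/
noncomputable def hurwitzGraphIso {n : ℕ} (hn : cs.absLength c = n) :
    factorizationGraph {t | cs.IsReflection t} n c ≃g cs.hurwitzGraph c where
  toEquiv := Equiv.ofBijective _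
    ⟨Factorization.toFlag_injective hn, Factorization.toFlag_surjective hn⟩
  map_rel_iff' {l m} := by
    change ((Factorization.toFlag hn l : Set (cs.NC c)) \
        (Factorization.toFlag hn m : Set (cs.NC c))).ncard = 1 ∧
      ((Factorization.toFlag hn m : Set (cs.NC c)) \
        (Factorization.toFlag hn l : Set (cs.NC c))).ncard = 1 ↔ ∃! i : ℕ, _
    rw [Factorization.ncard_toFlag_sdiff, Factorization.ncard_toFlag_sdiff]
    simp only [ne_comm (a := (List.take _ m.1).prod), and_self, Set.ncard_eq_one,
      Set.eq_singleton_iff_unique_mem, ExistsUnique, Set.mem_ofPred_eq]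

end CoxeterSystem

/-! ### The lower bound for the radius -/

theorem SimpleGraph.le_edist_of_forall_adj {V : Type*} {G : SimpleGraph V} (f : V → ℕ)
    (hf : ∀ u v, G.Adj u v → f v ≤ f u + 1) {u v : V} {k : ℕ} (h : f u + k ≤ f v) :
    (k : ℕ∞) ≤ G.edist u v := by
  by_cases htop : G.edist u v = ⊤
  · rw [htop]; exact le_top
  · obtain ⟨p, hp⟩ := SimpleGraph.exists_walk_of_edist_ne_top htop
    have key : ∀ {u v : V} (p : G.Walk u v), f v ≤ f u + p.length := by
      intro u v p
      induction p with
      | nil => simp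
      | cons hadj p ih =>
        have := hf _ _ hadj
        rw [SimpleGraph.Walk.length_cons]
        omega
    have := key p
    rw [← hp]
    exact_mod_cast (by omega : k ≤ p.length)

/-! ### Position of a subspace relative to a complete flag. -/

section Pivots

variable {K V : Type*} [DivisionRing K] [AddCommGroup V] [Module K V]

open Classical in
/-- The jumps in the intersection of `F` with the members of the flag `G`. -/
noncomputable def Submodule.pivots (G : ℕ → Submodule K V) (n : ℕ) (F : Submodule K V) :
    Finset ℕ :=
  {j ∈ Finset.range n | ∃ v ∈ F, v ∈ G (j + 1) ∧ v ∉ G j}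

variable {G : ℕ → Submodule K V} {n : ℕ}

theorem Submodule.mem_pivots {F : Submodule K V} {j : ℕ} :
    j ∈ F.pivots G n ↔ j < n ∧ ∃ v ∈ F, v ∈ G (j + 1) ∧ v ∉ G j := by
  simp [pivots]

theorem Submodule.pivots_mono {F F' : Submodule K V} (h : F ≤ F') :
    F.pivots G n ⊆ F'.pivots G n := by
  intro j hj
  rw [mem_pivots] at hj ⊢
  obtain ⟨hj, v, hv, h'⟩ := hj
  exact ⟨hj, v, h hv, h'⟩

variable [FiniteDimensional K V]

/-- Passing from $G_j$ to $G_{j+1}$ raises the dimension of the intersection with $F$ by at most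
one, and raises it exactly when $j$ is a pivot. -/
theorem Submodule.finrank_inf_eq_card_pivots (hG : Monotone G)
    (hrank : ∀ j ≤ n, Module.finrank K (G j) = j) (F : Submodule K V) :
    ∀ j ≤ n, Module.finrank K (F ⊓ G j : Submodule K V) = (F.pivots G j).card := by
  intro j
  induction j with
  | zero =>
    intro h
    have : G 0 = ⊥ := Submodule.finrank_eq_zero.1 (hrank 0 h)
    simp [this, pivots]
  | succ j ih =>
    intro h
    have ihj := ih (by omega)
    have hle : G j ≤ G (j + 1) := hG (by omega)
    by_cases hv : ∃ v ∈ F, v ∈ G (j + 1) ∧ v ∉ G j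
    · have hp : F.pivots G (j + 1) = insert j (F.pivots G j) := by
        ext i
        simp only [mem_pivots, Finset.mem_insert]
        constructor
        · rintro ⟨hi, h⟩
          rcases Nat.lt_succ_iff_lt_or_eq.1 hi with h' | h'
          · exact Or.inr ⟨h', h⟩
          · exact Or.inl h'
        · rintro (rfl | ⟨hi, h⟩)
          · exact ⟨by omega, hv⟩
          · exact ⟨by omega, h⟩
      rw [hp, Finset.card_insert_of_notMem (by simp [mem_pivots]), ← ihj]
      have h1 := Submodule.finrank_sup_add_finrank_inf_eq (F ⊓ G (j + 1)) (G j)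
      have h2 : F ⊓ G (j + 1) ⊓ G j = F ⊓ G j := by
        rw [inf_assoc, inf_eq_right.2 hle]
      have h3 : Module.finrank K (F ⊓ G (j + 1) ⊔ G j : Submodule K V) ≤ j + 1 := by
        refine (Submodule.finrank_mono (sup_le inf_le_right hle)).trans_eq (hrank _ h)
      have h4 : Module.finrank K (F ⊓ G j : Submodule K V) <
          Module.finrank K (F ⊓ G (j + 1) : Submodule K V) := by
        apply Submodule.finrank_lt_finrank_of_lt
        refine lt_of_le_of_ne (inf_le_inf_left _ hle) fun heq => ?_
        obtain ⟨v, hvF, hv1, hv2⟩ := hv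
        exact hv2 (heq.ge ⟨hvF, hv1⟩).2
      rw [h2, hrank j (by omega)] at h1
      omega
    · have hp : F.pivots G (j + 1) = F.pivots G j := by
        ext i
        simp only [mem_pivots]
        refine and_congr_left fun hi' => ⟨fun hi => ?_, fun hi => by omega⟩
        rcases Nat.lt_succ_iff_lt_or_eq.1 hi with h' | rfl
        · exact h'
        · exact absurd hi' hv
      rw [hp, ← ihj]
      have : F ⊓ G (j + 1) = F ⊓ G j := by
        apply le_antisymm _ (inf_le_inf_left _ hle)
        rintro v ⟨h1, h2⟩
        refine ⟨h1, ?_⟩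
        by_contra h3
        exact hv ⟨v, h1, h2, h3⟩
      rw [this]

theorem Submodule.card_pivots (hG : Monotone G)
    (hrank : ∀ j ≤ n, Module.finrank K (G j) = j) (htop : G n = ⊤) (F : Submodule K V) :
    (F.pivots G n).card = Module.finrank K F := by
  rw [← finrank_inf_eq_card_pivots hG hrank F n le_rfl, htop, inf_top_eq]

end Pivots

/-! ### Inversions of increasing families of finite sets. -/

section Inversions

/-- The pairs `a < b` such that `b` enters the increasing family `P` of sets before `a`. -/
noncomputable def Finset.inversions (n : ℕ) (P : ℕ → Finset ℕ) : Finset (Σ _ : ℕ, ℕ) :=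
  open Classical in
  {p ∈ (Finset.range n).sigma Finset.range | ∃ i, p.1 ∈ P i ∧ p.2 ∉ P i}

theorem Finset.card_sigma_range (n : ℕ) :
    ((Finset.range n).sigma Finset.range).card = n.choose 2 := by
  simp [Finset.card_sigma, Finset.sum_range_id, Nat.choose_two_right]

/-- An inversion of $P$ that is lost in $Q$ is witnessed only at the index $i$. So its larger entry
enters $P$ at step $i$ and its smaller one at step $i+1$; as at most one number enters at each step,
only one pair qualifies. -/
theorem Finset.card_inversions_le {n : ℕ} {P Q : ℕ → Finset ℕ} (hP : Monotone P)
    (hcard : ∀ i, (P (i + 1)).card ≤ (P i).card + 1) (h0 : P 0 = ∅) {i : ℕ}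
    (h : ∀ j, j ≠ i → P j = Q j) :
    (Finset.inversions n P).card ≤ (Finset.inversions n Q).card + 1 := by
  classical
  have hsub : Finset.inversions n P ⊆
      Finset.inversions n Q ∪ (Finset.inversions n P \ Finset.inversions n Q) := by
    intro p; simp; tauto
  refine (Finset.card_le_card hsub).trans ((Finset.card_union_le _ _).trans ?_)
  gcongr
  have hstep : ∀ k, ∀ x ∈ P (k + 1) \ P k, ∀ y ∈ P (k + 1) \ P k, x = y := by
    intro k
    rw [← Finset.card_le_one]
    have := Finset.card_sdiff_add_card_eq_card (hP (Nat.le_succ k))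
    have := hcard k
    simp only [Nat.succ_eq_add_one] at *
    omega
  have key : ∀ p ∈ Finset.inversions n P \ Finset.inversions n Q,
      (1 ≤ i ∧ p.1 ∈ P (i - 1 + 1) \ P (i - 1)) ∧ p.2 ∈ P (i + 1) \ P i := by
    intro p hp
    simp only [inversions, Finset.mem_sdiff, Finset.mem_filter, not_and, not_exists,
      not_not] at hp
    obtain ⟨⟨hp, j, hj1, hj2⟩, hn⟩ := hp
    have hn := hn hp
    obtain rfl : j = i := by
      by_contra hji
      exact hj2 (h j hji ▸ hn j (h j hji ▸ hj1))
    have hj0 : 1 ≤ j := by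
      by_contra hj
      obtain rfl : j = 0 := by omega
      simp [h0] at hj1
    refine ⟨⟨hj0, ?_⟩, ?_⟩
    · rw [Nat.sub_add_cancel hj0, Finset.mem_sdiff]
      refine ⟨hj1, fun hc => hj2 (hP (Nat.sub_le j 1) ?_)⟩
      rw [h (j - 1) (by omega)] at hc ⊢
      exact hn _ hc
    · rw [Finset.mem_sdiff]
      refine ⟨?_, hj2⟩
      rw [h (j + 1) (by omega)]
      apply hn
      rw [← h (j + 1) (by omega)]
      exact hP (Nat.le_succ j) hj1
  rw [Finset.card_le_one]
  intro p hp q hq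
  obtain ⟨⟨-, hp1⟩, hp2⟩ := key p hp
  obtain ⟨⟨-, hq1⟩, hq2⟩ := key q hq
  exact Sigma.ext (hstep _ _ hp1 _ hq1) (heq_of_eq (hstep _ _ hp2 _ hq2))

end Inversions

/-! ### The flag of moved spaces of a maximal chain, and opposite chains. -/

namespace CoxeterSystem

variable {B W : Type*} [Group W] {M : CoxeterMatrix B} (cs : CoxeterSystem M W) {c : W}

variable {cs} in
theorem Factorization.absLE_of_le {n : ℕ} (hn : cs.absLength c = n)
    (l : Factorization {t | cs.IsReflection t} n c) {i j : ℕ} (hij : i ≤ j) :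
    cs.AbsLE (l.1.take i).prod (l.1.take j).prod := by
  obtain ⟨l, hlen, hr, rfl⟩ := l
  rw [← hlen] at hn
  exact CoxeterSystem.absLE_prod_take cs hr hn hij

variable {cs} in
/-- The factorization whose partial products are the products of the final segments of `l`. -/
theorem Factorization.exists_prod_take_eq_prod_drop {n : ℕ}
    (l : Factorization {t | cs.IsReflection t} n c) :
    ∃ m : Factorization {t | cs.IsReflection t} n c,
      ∀ i ≤ n, (m.1.take i).prod = (l.1.drop (n - i)).prod := by
  obtain ⟨l, rfl, hr, rfl⟩ := l
  have h := fun i hi => List.prod_take_ofFn_inv_mul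
    (fun k => (l.drop (l.length - k)).prod) l.length i hi
  simp only [Nat.sub_zero, List.drop_length, List.prod_nil, inv_one, one_mul] at h
  refine ⟨⟨_, List.length_ofFn, ?_, ?_⟩, h⟩
  · intro t ht
    obtain ⟨k, rfl⟩ := (List.mem_ofFn' _ _).1 ht
    -- With $d$ the product of a final segment and $t$ the factor before it, the quotient is
    -- $d^{-1}td$, a reflection.
    have hk : l.length - (k + 1) < l.length := by have := k.2; omega
    have e : l.length - (k + 1) + 1 = l.length - k := by have := k.2; omega
    have hd := List.drop_eq_getElem_cons hk
    rw [e] at hd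
    change cs.IsReflection ((l.drop (l.length - k)).prod⁻¹ * (l.drop (l.length - (k + 1))).prod)
    rw [hd, List.prod_cons, ← mul_assoc]
    nth_rw 2 [← inv_inv (l.drop (l.length - k)).prod]
    rw [isReflection_conj_iff]
    exact hr _ (List.getElem_mem hk)
  · have := h l.length le_rfl
    rwa [List.take_of_length_le (by simp), Nat.sub_self, List.drop_zero] at this

variable [Fintype B] [DecidableEq B]

/-- $\mathrm{Mov}(x)$ and $\mathrm{Mov}(x^{-1}c)$ span the whole space, their dimensions are at most
the two lengths, and these lengths add up to $n$; so equality holds throughout. -/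
theorem finrank_moved_of_absLE (htop : cs.moved c = ⊤) (hc : cs.absLength c = Fintype.card B)
    {x : W} (hx : cs.AbsLE x c) : Module.finrank ℝ (cs.moved x) = cs.absLength x := by
  have h1 := Submodule.finrank_mono (cs.moved_mul_le x (x⁻¹ * c))
  rw [mul_inv_cancel_left, htop, finrank_top, Module.finrank_fintype_fun_eq_card, ← hc] at h1
  have h2 := Submodule.finrank_add_le_finrank_add_finrank (cs.moved x) (cs.moved (x⁻¹ * c))
  have h3 := cs.finrank_moved_le x
  have h4 := cs.finrank_moved_le (x⁻¹ * c)
  change cs.absLength c = cs.absLength x + cs.absLength (x⁻¹ * c) at hx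
  omega

/-- $\mathrm{Mov}(y)$ lies in $\mathrm{Mov}(x)+\mathrm{Mov}(x^{-1}y)$, whose dimension is at most
$\ell(y)=\dim\mathrm{Mov}(y)$; hence the two coincide. -/
theorem moved_le_moved (htop : cs.moved c = ⊤) (hc : cs.absLength c = Fintype.card B)
    {x y : W} (hxy : cs.AbsLE x y) (hy : cs.AbsLE y c) : cs.moved x ≤ cs.moved y := by
  have h1 := cs.moved_mul_le x (x⁻¹ * y)
  rw [mul_inv_cancel_left] at h1
  have h2 := Submodule.finrank_add_le_finrank_add_finrank (cs.moved x) (cs.moved (x⁻¹ * y))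
  have h3 := cs.finrank_moved_le x
  have h4 := cs.finrank_moved_le (x⁻¹ * y)
  have h5 := cs.finrank_moved_of_absLE htop hc hy
  change cs.absLength y = cs.absLength x + cs.absLength (x⁻¹ * y) at hxy
  rw [Submodule.eq_of_le_of_finrank_le h1 (by omega)]
  exact le_sup_left

theorem moved_inf_moved_eq_bot (htop : cs.moved c = ⊤) (hc : cs.absLength c = Fintype.card B)
    {x : W} (hx : cs.AbsLE x c) : cs.moved x ⊓ cs.moved (x⁻¹ * c) = ⊥ := by
  have h1 := cs.moved_mul_le x (x⁻¹ * c)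
  rw [mul_inv_cancel_left, htop, top_le_iff] at h1
  have h2 := Submodule.finrank_sup_add_finrank_inf_eq (cs.moved x) (cs.moved (x⁻¹ * c))
  rw [h1, finrank_top, Module.finrank_fintype_fun_eq_card, ← hc] at h2
  have h3 := cs.finrank_moved_le x
  have h4 := cs.finrank_moved_le (x⁻¹ * c)
  change cs.absLength c = cs.absLength x + cs.absLength (x⁻¹ * c) at hx
  rw [← Submodule.finrank_eq_zero (R := ℝ)]
  omega

variable {cs}

/-- The number of inversions relative to the flag of $l$ is a 1-Lipschitz function on the graph. It
is $0$ at $l$ and $\binom n2$ at the opposite chain $m$. -/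
theorem Factorization.exists_choose_two_le_edist [Finite W] (hc : cs.IsCoxeterElement c)
    {n : ℕ} (hcard : Fintype.card B = n) (l : Factorization {t | cs.IsReflection t} n c) :
    ∃ m, (n.choose 2 : ℕ∞) ≤ (factorizationGraph _ _ c).edist l m := by
  obtain ⟨m, hm⟩ := Factorization.exists_prod_take_eq_prod_drop l
  have hn' := cs.absLength_coxeterElement hc
  have hn := hn'.trans hcard
  have htop := cs.moved_eq_top hc
  set G : ℕ → Submodule ℝ (B → ℝ) := fun j => cs.moved (l.1.take j).prod with hG
  have hmono : ∀ m : Factorization {t | cs.IsReflection t} n c,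
      Monotone fun j => cs.moved (m.1.take j).prod := fun m i j hij =>
    cs.moved_le_moved htop hn' (absLE_of_le hn m hij) (absLE_prod_take hn m j)
  have hrank : ∀ (m : Factorization {t | cs.IsReflection t} n c) (j : ℕ),
      Module.finrank ℝ (cs.moved (m.1.take j).prod) = min j n := fun m j => by
    rw [cs.finrank_moved_of_absLE htop hn' (absLE_prod_take hn m j), absLength_prod_take hn]
  set P : Factorization {t | cs.IsReflection t} n c → ℕ → Finset ℕ :=
    fun m i => (cs.moved (m.1.take i).prod).pivots G n with hP
  have hPcard : ∀ m i, (P m i).card = min i n := by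
    intro m i
    rw [hP, Submodule.card_pivots (hmono l) (fun j hj => by rw [hrank, min_eq_left hj])
      ((congrArg cs.moved (prod_take_of_le l le_rfl)).trans htop), hrank]
  have hPmono : ∀ m, Monotone (P m) := fun m i j hij => Submodule.pivots_mono (hmono m hij)
  refine ⟨m, SimpleGraph.le_edist_of_forall_adj
    (fun m => (Finset.inversions n (P m)).card) ?_ ?_⟩
  · rintro u v ⟨i, -, hi⟩
    refine Finset.card_inversions_le (i := i) (hPmono v) ?_ ?_ ?_
    · intro i; rw [hPcard, hPcard]; omega
    · rw [← Finset.card_eq_zero, hPcard]; simp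
    · intro j hj
      rw [hP]
      dsimp only
      congr 2
      by_contra hne
      exact hj (hi j (Ne.symm hne))
  -- Relative to itself, the flag of $l$ has the pivots $0,\dots,i-1$ at stage $i\le n$: the
  -- identity permutation.
  · have h0 : Finset.inversions n (P l) = ∅ := by
      rw [Finset.eq_empty_iff_forall_notMem]
      intro p hp
      simp only [Finset.inversions, Finset.mem_filter, Finset.mem_sigma, Finset.mem_range] at hp
      obtain ⟨⟨hp1, hp2⟩, i, hi1, hi2⟩ := hp
      have hsub : P l i = Finset.range (min i n) := by
        apply Finset.eq_of_subset_of_card_le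
        · intro j hj
          obtain ⟨hj, v, hv, hv1, hv2⟩ := Submodule.mem_pivots.1 hj
          rw [Finset.mem_range, lt_min_iff]
          refine ⟨?_, hj⟩
          by_contra hij
          push Not at hij
          exact hv2 (hmono l hij hv)
        · rw [hPcard, Finset.card_range]
      rw [hsub, Finset.mem_range] at hi1 hi2
      omega
    have h1 : Finset.inversions n (P m) = (Finset.range n).sigma Finset.range := by
      classical
      apply Finset.filter_true_of_mem
      intro p hp
      simp only [Finset.mem_sigma, Finset.mem_range] at hp
      -- At stage $n-p$ the chain $m$ has reached $x_p^{-1}c$, whose moved space meets $G_p$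
      -- trivially. So no pivot is below $p$, and there are $n-p$ of them.
      have hPm : P m (n - p.1) = Finset.Ico p.1 n := by
        apply Finset.eq_of_subset_of_card_le
        · intro j hj
          obtain ⟨hj, v, hv, hv1, hv2⟩ := Submodule.mem_pivots.1 hj
          rw [Finset.mem_Ico]
          refine ⟨?_, hj⟩
          by_contra hij
          push Not at hij
          have hbot := cs.moved_inf_moved_eq_bot htop hn' (absLE_prod_take hn l p.1)
          rw [hm _ (Nat.sub_le _ _), Nat.sub_sub_self hp.1.le] at hv
          have hd : (l.1.take p.1).prod⁻¹ * c = (l.1.drop p.1).prod := by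
            rw [inv_mul_eq_iff_eq_mul, List.prod_take_mul_prod_drop, l.2.2.2]
          rw [hd] at hbot
          have : v ∈ (⊥ : Submodule ℝ (B → ℝ)) := by
            rw [← hbot]
            exact ⟨hmono l (by omega : j + 1 ≤ p.1) hv1, hv⟩
          rw [Submodule.mem_bot] at this
          exact hv2 (this ▸ zero_mem _)
        · rw [hPcard, Nat.card_Ico]; omega
      refine ⟨n - p.1, ?_, ?_⟩
      · rw [hPm, Finset.mem_Ico]; omega
      · rw [hPm, Finset.mem_Ico]; omega
    rw [h0, h1, Finset.card_sigma_range]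
    simp

end CoxeterSystem

/-! ### Invariance under isomorphisms -/

namespace SimpleGraph

variable {V V' : Type*} {G : SimpleGraph V} {G' : SimpleGraph V'}

theorem Hom.edist_le (f : G →g G') (u v : V) : G'.edist (f u) (f v) ≤ G.edist u v := by
  by_cases h : G.edist u v = ⊤
  · rw [h]; exact le_top
  · obtain ⟨p, hp⟩ := exists_walk_of_edist_ne_top h
    rw [← hp, ← Walk.length_map f p]
    exact SimpleGraph.edist_le _

theorem Iso.edist_eq (f : G ≃g G') (u v : V) : G'.edist (f u) (f v) = G.edist u v := by
  apply le_antisymm (Hom.edist_le f.toHom u v)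
  simpa using! Hom.edist_le f.symm.toHom (f u) (f v)

theorem Iso.eccent_eq (f : G ≃g G') (u : V) : G'.eccent (f u) = G.eccent u := by
  rw [eccent, eccent, ← f.toEquiv.surjective.iSup_comp]
  exact iSup_congr fun v => f.edist_eq u v

theorem Iso.radius_eq (f : G ≃g G') : G'.radius = G.radius := by
  rw [radius, radius, ← f.toEquiv.surjective.iInf_comp]
  exact iInf_congr fun v => f.eccent_eq v

theorem Iso.ediam_eq (f : G ≃g G') : G'.ediam = G.ediam := by
  rw [ediam, ediam, ← f.toEquiv.surjective.iSup_comp]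
  exact iSup_congr fun v => f.eccent_eq v

end SimpleGraph

/-- An injective homomorphism of groups induces an isomorphism of the graphs of factorizations. -/
noncomputable def factorizationGraphIso {G H : Type*} [Group G] [Group H] (e : G →* H)
    (he : Function.Injective e) {R : Set G} {S : Set H} (h : e '' R = S) (n : ℕ) {c : G} {d : H}
    (hcd : e c = d) : factorizationGraph R n c ≃g factorizationGraph S n d where
  toEquiv := Equiv.ofBijective
    (fun l => ⟨l.1.map e, by simp [l.2.1], by
      subst h
      intro t ht
      obtain ⟨s, hs, rfl⟩ := List.mem_map.1 ht
      exact ⟨s, l.2.2.1 s hs, rfl⟩, by rw [← map_list_prod, l.2.2.2, hcd]⟩) <| by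
    constructor
    · intro l m hlm
      exact Subtype.ext (List.map_injective_iff.2 he (congrArg Subtype.val hlm))
    · rintro ⟨l, hlen, hl, hprod⟩
      have : ∃ m : List G, m.map e = l ∧ ∀ t ∈ m, t ∈ R := by
        clear hlen hprod
        induction l with
        | nil => exact ⟨[], rfl, by simp⟩
        | cons t l ih =>
          obtain ⟨m, hm, hmR⟩ := ih fun s hs => hl s (by simp [hs])
          obtain ⟨s, hs, hst⟩ : t ∈ e '' R := h ▸ hl t (by simp)
          exact ⟨s :: m, by simp [hm, hst], by simpa [hs] using hmR⟩
      obtain ⟨m, rfl, hm⟩ := this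
      refine ⟨⟨m, by simpa using hlen, hm, he ?_⟩, rfl⟩
      rw [map_list_prod, hprod, hcd]
  map_rel_iff' {l m} := by
    change (∃! i : ℕ, ((l.1.map e).take i).prod ≠ ((m.1.map e).take i).prod) ↔
      ∃! i : ℕ, (l.1.take i).prod ≠ (m.1.take i).prod
    simp only [← List.map_take, ← map_list_prod, he.ne_iff]

namespace CoxeterSystem

variable {B W : Type*} [Group W] {M : CoxeterMatrix B}

/-- The Hurwitz graph only depends on the group, on its set of reflections and on the conjugacy
class of the Coxeter element. -/
theorem nonempty_factorizationGraph_iso_of_injective [Fintype B] [Finite W]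
    (cs : CoxeterSystem M W) {c : W} (hc : cs.IsCoxeterElement c) {G : Type*} [Group G]
    (e : W →* G) (he : Function.Injective e) {R : Set G} (hR : e '' {t | cs.IsReflection t} = R)
    {c' : W} (hc' : IsConj c c') {d : G} (hd : e c' = d) {n : ℕ} (hn : Fintype.card B = n) :
    Nonempty (factorizationGraph R n d ≃g cs.hurwitzGraph c) := by
  obtain ⟨g, rfl⟩ := isConj_iff.1 hc'
  have hconj : (MulAut.conj g).toMonoidHom '' {t | cs.IsReflection t} =
      {t | cs.IsReflection t} := by
    ext t
    constructor
    · rintro ⟨t, ht, rfl⟩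
      exact (cs.isReflection_conj_iff g t).2 ht
    · intro ht
      refine ⟨g⁻¹ * t * g⁻¹⁻¹, (cs.isReflection_conj_iff g⁻¹ t).2 ht, ?_⟩
      simp [mul_assoc]
  exact ⟨(factorizationGraphIso e he hR n hd).symm.trans
    ((factorizationGraphIso _ (MulAut.conj g).injective hconj n (c := c) rfl).symm.trans
      (cs.hurwitzGraphIso ((cs.absLength_coxeterElement hc).trans hn)))⟩

theorem nonempty_factorizationGraph_iso_hurwitzGraph [Fintype B] [Finite W]
    (cs : CoxeterSystem M W) {c : W} (hc : cs.IsCoxeterElement c) {G : Type*} [Group G]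
    (e : W ≃* G) {R : Set G} (hR : ∀ w, cs.IsReflection w ↔ e w ∈ R) {d : G}
    (hd : IsConj (e c) d) {n : ℕ} (hn : Fintype.card B = n) :
    Nonempty (factorizationGraph R n d ≃g cs.hurwitzGraph c) := by
  refine cs.nonempty_factorizationGraph_iso_of_injective hc e.toMonoidHom e.injective ?_
    (c' := e.symm d) ?_ (e.apply_symm_apply d) hn
  · ext t
    constructor
    · rintro ⟨t, ht, rfl⟩
      exact (hR t).1 ht
    · intro ht
      exact ⟨e.symm t, (hR _).2 (by rwa [e.apply_symm_apply]), e.apply_symm_apply t⟩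
  · obtain ⟨g, rfl⟩ := isConj_iff.1 hd
    exact isConj_iff.2 ⟨e.symm g, by simp⟩

theorem le_length_of_isConj [Fintype B] [Finite W]
    (cs : CoxeterSystem M W) {c : W} (hc : cs.IsCoxeterElement c) {G : Type*} [Group G]
    (e : W ≃* G) {R : Set G} (hR : ∀ w, cs.IsReflection w ↔ e w ∈ R) {d : G}
    (hd : IsConj (e c) d) {l : List G} (hl : ∀ t ∈ l, t ∈ R) (hld : l.prod = d) :
    Fintype.card B ≤ l.length := by
  have h1 : IsConj c (e.symm d) := by
    obtain ⟨g, rfl⟩ := isConj_iff.1 hd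
    exact isConj_iff.2 ⟨e.symm g, by simp⟩
  rw [← cs.absLength_coxeterElement hc, cs.absLength_mul_eq_of_isConj h1, ← hld, map_list_prod]
  refine (cs.absLength_le _ ?_).trans_eq (List.length_map _)
  intro t ht
  obtain ⟨s, hs, rfl⟩ := List.mem_map.1 ht
  rw [hR, e.apply_symm_apply]
  exact hl s hs

end CoxeterSystem

/-! ### Hurwitz moves -/

section Hurwitz

variable {G : Type*} [Group G] {R : Set G}

/-- The factorization `m` arises from `l` by the replacement of two consecutive factors by two
elements of `R` with the same product. -/
def HurwitzStep (R : Set G) (l m : List G) : Prop :=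
  ∃ (a b : List G) (x y x' y' : G), x' ∈ R ∧ y' ∈ R ∧ x * y = x' * y' ∧
    l = a ++ x :: y :: b ∧ m = a ++ x' :: y' :: b

/-- The factorization `m` arises from `l` by at most `k` Hurwitz steps. -/
inductive HurwitzReach (R : Set G) : ℕ → List G → List G → Prop
  | refl (k : ℕ) (l : List G) : HurwitzReach R k l l
  | step {k : ℕ} {l m m' : List G} :
    HurwitzReach R k l m → HurwitzStep R m m' → HurwitzReach R (k + 1) l m'

theorem HurwitzStep.append {l m : List G} (h : HurwitzStep R l m) (p q : List G) :
    HurwitzStep R (p ++ l ++ q) (p ++ m ++ q) := by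
  obtain ⟨a, b, x, y, x', y', hx, hy, hxy, rfl, rfl⟩ := h
  exact ⟨p ++ a, b ++ q, x, y, x', y', hx, hy, hxy, by simp, by simp⟩

theorem HurwitzReach.append {k : ℕ} {l m : List G} (h : HurwitzReach R k l m) (p q : List G) :
    HurwitzReach R k (p ++ l ++ q) (p ++ m ++ q) := by
  induction h with
  | refl => exact .refl _ _
  | step _ h ih => exact .step ih (h.append p q)

theorem HurwitzReach.succ {k : ℕ} {l m : List G} (h : HurwitzReach R k l m) :
    HurwitzReach R (k + 1) l m := by
  induction h with
  | refl => exact .refl _ _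
  | step _ h ih => exact .step ih h

theorem HurwitzReach.trans {j k : ℕ} {l m p : List G} (h : HurwitzReach R j l m)
    (h' : HurwitzReach R k m p) : HurwitzReach R (j + k) l p := by
  induction h' with
  | refl k p =>
    induction k with
    | zero => exact h
    | succ k ih => exact ih.succ
  | step _ h' ih => exact .step (ih h) h'

theorem HurwitzReach.mono {j k : ℕ} {l m : List G} (h : HurwitzReach R j l m) (hjk : j ≤ k) :
    HurwitzReach R k l m := by
  have := h.trans (.refl (k - j) m)
  rwa [Nat.add_sub_cancel' hjk] at this

theorem HurwitzStep.length_eq {l m : List G} (h : HurwitzStep R l m) :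
    m.length = l.length := by
  obtain ⟨a, b, x, y, x', y', hx, hy, hxy, rfl, rfl⟩ := h
  simp

theorem HurwitzStep.prod_eq {l m : List G} (h : HurwitzStep R l m) : m.prod = l.prod := by
  obtain ⟨a, b, x, y, x', y', hx, hy, hxy, rfl, rfl⟩ := h
  simp only [List.prod_append, List.prod_cons, ← mul_assoc x, hxy, ← mul_assoc x']

theorem HurwitzStep.mem {l m : List G} (h : HurwitzStep R l m) (hl : ∀ t ∈ l, t ∈ R) :
    ∀ t ∈ m, t ∈ R := by
  obtain ⟨a, b, x, y, x', y', hx, hy, hxy, rfl, rfl⟩ := h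
  intro t ht
  simp only [List.mem_append, List.mem_cons] at ht hl
  rcases ht with h | rfl | rfl | h
  · exact hl t (.inl h)
  · exact hx
  · exact hy
  · exact hl t (.inr (.inr (.inr h)))

theorem HurwitzReach.prod_eq {k : ℕ} {l m : List G} (h : HurwitzReach R k l m) :
    m.prod = l.prod := by
  induction h with
  | refl => rfl
  | step _ h ih => exact h.prod_eq.trans ih

/-- Only the partial product that ends between the two replaced factors can change. A step may also
be trivial, whence the inequality. -/
theorem HurwitzStep.edist_le_one {n : ℕ} {c : G} {u v : Factorization R n c}
    (h : HurwitzStep R u.1 v.1) : (factorizationGraph R n c).edist u v ≤ 1 := by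
  rw [SimpleGraph.edist_le_one_iff_adj_or_eq]
  obtain ⟨a, b, x, y, x', y', hx, hy, hxy, hu, hv⟩ := h
  by_cases hxx : x = x'
  · right
    subst hxx
    rw [mul_left_cancel_iff] at hxy
    exact Subtype.ext (by rw [hu, hv, hxy])
  · left
    refine ⟨a.length + 1, ?_, ?_⟩
    · dsimp only
      rw [hu, hv, List.take_length_add_append, List.take_length_add_append]
      simpa using hxx
    · intro i
      dsimp only
      rw [hu, hv]
      contrapose!
      intro hi
      rcases lt_or_gt_of_ne hi with hi | hi
      · rw [List.take_append_of_le_length (by omega), List.take_append_of_le_length (by omega)]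
      · obtain ⟨j, rfl⟩ := Nat.exists_eq_add_of_lt hi
        rw [show a.length + 1 + j + 1 = a.length + (j + 2) by ring,
          List.take_length_add_append, List.take_length_add_append]
        simp only [List.take_succ_cons, List.prod_append, List.prod_cons, ← mul_assoc x, hxy,
          ← mul_assoc x']

theorem HurwitzReach.edist_le {n k : ℕ} {c : G} {u v : Factorization R n c}
    (h : HurwitzReach R k u.1 v.1) : (factorizationGraph R n c).edist u v ≤ k := by
  obtain ⟨u, hu⟩ := u
  obtain ⟨v, hv⟩ := v
  dsimp only at h
  have key : ∃ hv', (factorizationGraph R n c).edist ⟨u, hu⟩ ⟨v, hv'⟩ ≤ k := by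
    clear hv
    induction h with
    | refl k l => exact ⟨hu, by rw [SimpleGraph.edist_self]; exact zero_le⟩
    | @step k l m m' _ h ih =>
      obtain ⟨hm, hle⟩ := ih hu
      have hm' : m'.length = n ∧ (∀ t ∈ m', t ∈ R) ∧ m'.prod = c :=
        ⟨h.length_eq.trans hm.1, h.mem hm.2.1, h.prod_eq.trans hm.2.2⟩
      refine ⟨hm', (SimpleGraph.edist_triangle (v := ⟨m, hm⟩)).trans ?_⟩
      rw [Nat.cast_add, Nat.cast_one]
      exact add_le_add hle (HurwitzStep.edist_le_one h)
  obtain ⟨_, h⟩ := key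
  exact h

end Hurwitz

/-! ### Factorizations of a long cycle into transpositions -/

namespace Equiv.Perm

variable {α : Type*}

theorem prod_apply_eq_self {l : List (Perm α)} {q : α} (h : ∀ t ∈ l, t q = q) :
    l.prod q = q := by
  induction l with
  | nil => simp
  | cons t l ih =>
    rw [List.prod_cons, mul_apply, ih fun t ht => h t (by simp [ht]), h t (by simp)]

variable [DecidableEq α]

theorem IsSwap.eq_swap_of_apply {t : Perm α} (ht : t.IsSwap) {x y : α} (hxy : x ≠ y)
    (h : t x = y) : t = swap x y := by
  obtain ⟨a, b, hab, rfl⟩ := ht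
  subst h
  rcases eq_or_ne x a with rfl | ha
  · rw [swap_apply_left]
  · rcases eq_or_ne x b with rfl | hb
    · rw [swap_apply_right, swap_comm]
    · exact absurd (swap_apply_of_ne_of_ne ha hb).symm hxy

theorem IsSwap.conj {t : Perm α} (ht : t.IsSwap) (g : Perm α) : (g * t * g⁻¹).IsSwap := by
  obtain ⟨a, b, hab, rfl⟩ := ht
  exact ⟨g a, g b, g.injective.ne hab, by
    rw [Equiv.swap_apply_apply g a b]⟩

/-- This supplies the move $(q\,p)\,t=t'\,(q\;t(p))$. If $t$ fixes $p$, then $t'$ is a conjugate of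
$t$; if $t=(p\,r)$ with $r\ne q$, then $t'=t$. -/
theorem isSwap_swap_mul_mul_swap {t : Perm α} (ht : t.IsSwap) {q p : α} (hpq : p ≠ q)
    (htp : t ≠ swap q p) : (swap q p * t * swap q (t p)).IsSwap := by
  have hconj : (swap q p * t * swap q p).IsSwap := by
    simpa using ht.conj (swap q p)
  by_cases h1 : t p = p
  · rwa [h1]
  · have ht' := ht.eq_swap_of_apply (Ne.symm h1) rfl
    have h2 : t p ≠ q := by
      intro h
      rw [h, swap_comm] at ht'
      exact htp ht'
    have : swap q p * t * swap q (t p) = t := by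
      have h3 := Equiv.swap_mul_swap_mul_swap (x := q) (y := p) (z := t p) hpq.symm h2.symm
      rw [← ht', swap_comm (t p)] at h3
      have htt : t * t = 1 := by
        obtain ⟨a, b, -, rfl⟩ := ht
        exact Equiv.swap_mul_self a b
      rw [← h3, ← mul_assoc, ← mul_assoc, mul_assoc _ t t, htt, mul_one,
        Equiv.swap_mul_self, one_mul]
    rwa [this]

/-- The transposition `(q p)` can be moved to the end of the list. -/
theorem exists_hurwitzReach_concat (q : α) (b : List (Perm α)) (p : α) (hpq : p ≠ q)
    (hb : ∀ t ∈ b, t.IsSwap)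
    (hmin : ∀ l : List (Perm α), (∀ t ∈ l, t.IsSwap) → l.prod = (swap q p :: b).prod →
      b.length + 1 ≤ l.length) :
    ∃ (b' : List (Perm α)) (p' : α), p' ≠ q ∧ b'.length = b.length ∧
      (∀ t ∈ b', t.IsSwap ∧ t q = q) ∧
      HurwitzReach {t | t.IsSwap} b.length (swap q p :: b) (b' ++ [swap q p']) := by
  induction b generalizing p with
  | nil => exact ⟨[], p, hpq, rfl, by simp, .refl _ _⟩
  | cons t b ih =>
    have ht : t.IsSwap := hb t (by simp)
    -- Otherwise the two factors would cancel, against minimality.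
    have htp : t ≠ swap q p := by
      rintro rfl
      have := hmin b (fun s hs => hb s (by simp [hs])) (by simp)
      simp at this
    have h1 : t p ≠ q := by
      intro h
      apply htp
      rw [ht.eq_swap_of_apply hpq h, swap_comm]
    set t' := swap q p * t * swap q (t p) with ht'def
    have ht' : t'.IsSwap := isSwap_swap_mul_mul_swap ht hpq htp
    have hprod : swap q p * t = t' * swap q (t p) := by simp [ht'def, mul_assoc]
    have htt : t (t p) = p := by
      obtain ⟨x, y, -, rfl⟩ := ht
      exact Equiv.swap_apply_self x y p
    -- The factor left behind fixes $q$; the one that moves $q$ has passed one place to the right.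
    have ht'q : t' q = q := by simp [ht'def, htt]
    obtain ⟨b', p', hp', hlen, hb', hr⟩ := ih (t p) h1 (fun s hs => hb s (by simp [hs])) (by
      intro l hl hlp
      have := hmin (t' :: l) (by
        intro s hs
        rcases List.mem_cons.1 hs with rfl | hs
        · exact ht'
        · exact hl s hs) (by
        rw [List.prod_cons, hlp, List.prod_cons, List.prod_cons, List.prod_cons, ← mul_assoc,
          ← mul_assoc, hprod])
      simpa using this)
    refine ⟨t' :: b', p', hp', by simp [hlen], ?_, ?_⟩
    · intro s hs
      rcases List.mem_cons.1 hs with rfl | hs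
      · exact ⟨ht', ht'q⟩
      · exact hb' s hs
    · have h2 : HurwitzReach {t : Perm α | t.IsSwap} 1 (swap q p :: t :: b)
          (t' :: swap q (t p) :: b) :=
        .step (.refl 0 _) ⟨[], b, _, _, _, _, ht', ⟨q, t p, h1.symm, rfl⟩, hprod, rfl, rfl⟩
      have h3 := h2.trans (by simpa using hr.append [t'] [])
      rw [List.length_cons, Nat.add_comm]
      simpa using h3

/-- The factorization of a cycle into the transpositions of consecutive elements. -/
def adjacentSwaps (p : ℕ → α) (k : ℕ) : List (Perm α) :=
  (List.range k).map fun i => swap (p i) (p (i + 1))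

theorem adjacentSwaps_succ (p : ℕ → α) (k : ℕ) :
    adjacentSwaps p (k + 1) = adjacentSwaps p k ++ [swap (p k) (p (k + 1))] := by
  simp [adjacentSwaps, List.range_succ]

/-- Induction on $k$: the first factor moving the last point is pushed to the end in at most $k-1$
steps, after which it is the only factor moving that point and can be split off. -/
theorem hurwitzReach_adjacentSwaps (p : ℕ → α) (k : ℕ)
    (hp : ∀ i ≤ k, ∀ j ≤ k, p i = p j → i = j) (l : List (Perm α)) (hl : ∀ t ∈ l, t.IsSwap)
    (hlen : l.length = k) (hprod : l.prod = (adjacentSwaps p k).prod)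
    (hmin : ∀ m : List (Perm α), (∀ t ∈ m, t.IsSwap) → m.prod = l.prod → k ≤ m.length) :
    HurwitzReach {t | t.IsSwap} (k.choose 2) l (adjacentSwaps p k) := by
  induction k generalizing l with
  | zero =>
    rw [List.length_eq_zero_iff] at hlen
    subst hlen
    exact .refl _ _
  | succ k ih =>
    set q := p (k + 1) with hq
    set C := (adjacentSwaps p k).prod with hC
    have hpk : p k ≠ q := fun h => by
      have := hp k (by omega) (k + 1) le_rfl h; omega
    have hCq : C q = q := by
      apply prod_apply_eq_self
      intro t ht
      obtain ⟨i, hi, rfl⟩ := List.mem_map.1 ht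
      rw [List.mem_range] at hi
      apply swap_apply_of_ne_of_ne
      · intro h
        have := hp (k + 1) le_rfl i (by omega) h; omega
      · intro h
        have := hp (k + 1) le_rfl (i + 1) (by omega) h; omega
    rw [adjacentSwaps_succ, List.prod_append, List.prod_singleton, ← hC, ← hq] at hprod
    have hex : ∃ t ∈ l, t q ≠ q := by
      by_contra! h
      have h1 := prod_apply_eq_self h
      rw [hprod, mul_apply, swap_apply_right] at h1
      exact hpk (C.injective (h1.trans hCq.symm))
    -- the first factor that moves `q`
    obtain ⟨a, t, b, rfl, ha, htq⟩ : ∃ a t b, l = a ++ t :: b ∧ (∀ s ∈ a, s q = q) ∧ t q ≠ q := by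
      clear hl hlen hprod hmin ih
      induction l with
      | nil => simp at hex
      | cons s l ih =>
        by_cases hs : s q = q
        · obtain ⟨a, t, b, rfl, ha, ht⟩ := ih (by
            obtain ⟨t, ht, htq⟩ := hex
            rcases List.mem_cons.1 ht with rfl | ht
            · exact absurd hs htq
            · exact ⟨t, ht, htq⟩)
          refine ⟨s :: a, t, b, rfl, ?_, ht⟩
          simpa [hs] using ha
        · exact ⟨[], s, l, rfl, by simp, hs⟩
    obtain ⟨r, hrq, rfl⟩ : ∃ r, r ≠ q ∧ t = swap q r :=
      ⟨t q, htq, (hl t (by simp)).eq_swap_of_apply (Ne.symm htq) rfl⟩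
    obtain ⟨b', r', hr', hlen', hb', hreach⟩ := exists_hurwitzReach_concat q b r hrq
      (fun t ht => hl t (by simp [ht])) (by
        intro m hm hmb
        have := hmin (a ++ m) (by
          intro s hs
          rcases List.mem_append.1 hs with hs | hs
          · exact hl s (by simp [hs])
          · exact hm s hs) (by rw [List.prod_append, List.prod_append, hmb])
        simp only [List.length_append, List.length_cons] at this hlen
        omega)
    have hreach' := hreach.append a []
    simp only [List.append_nil] at hreach'
    rw [← List.append_assoc] at hreach'
    have hprod' := hreach'.prod_eq.trans hprod
    rw [List.prod_append, List.prod_singleton] at hprod'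
    have hmq : (a ++ b').prod q = q := by
      apply prod_apply_eq_self
      intro t ht
      rcases List.mem_append.1 ht with ht | ht
      · exact ha t ht
      · exact (hb' t ht).2
    -- All other factors fix $q$, so the product sends $r'$ to $q$; the target product sends only
    -- $p_k$ to $q$.
    have hr'k : r' = p k := by
      have h1 := congrArg (fun σ : Perm α => σ r') hprod'
      simp only [mul_apply, swap_apply_right, hmq] at h1
      have h2 := C.injective (hCq.trans h1)
      rw [← (swap (p k) q).injective.eq_iff, Equiv.swap_apply_self, swap_apply_right] at h2
      exact h2.symm
    rw [hr'k, swap_comm q, mul_left_inj] at hprod'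
    have hlen2 : (a ++ b').length = k := by
      simp only [List.length_append, List.length_cons] at hlen ⊢
      omega
    have hr2 := ih (fun i hi j hj => hp i (by omega) j (by omega)) (a ++ b') (by
        intro t ht
        rcases List.mem_append.1 ht with ht | ht
        · exact hl t (by simp [ht])
        · exact (hb' t ht).1) hlen2 hprod' (by
        intro m hm hmC
        have := hmin (m ++ [swap (p k) q]) (by
          intro s hs
          rcases List.mem_append.1 hs with hs | hs
          · exact hm s hs
          · rw [List.mem_singleton.1 hs]; exact ⟨_, _, hpk, rfl⟩) (by
          rw [List.prod_append, hmC, hprod', hprod, List.prod_singleton])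
        simpa using this)
    have hr3 := hr2.append [] [swap (p k) q]
    rw [List.nil_append, List.nil_append] at hr3
    rw [hr'k, swap_comm q (p k)] at hreach'
    rw [adjacentSwaps_succ]
    refine (hreach'.trans hr3).mono ?_
    rw [Nat.choose_succ_succ' k 1, Nat.choose_one_right, one_add_one_eq_two]
    simp only [List.length_append, List.length_cons] at hlen
    omega

end Equiv.Perm

/-! ### Coxeter groups of type `A` -/

/-- If `S` permutes the cosets of `H` represented by `T`, then these cosets cover `⟨S⟩`. -/
theorem Subgroup.exists_eq_mul_of_mem_closure {G : Type*} [Group G] {S T : Set G}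
    {H : Subgroup G} (h1 : 1 ∈ T) (hinv : ∀ s ∈ S, s⁻¹ = s)
    (hS : ∀ s ∈ S, ∀ g ∈ T, ∃ g' ∈ T, ∃ h ∈ H, s * g = g' * h) {w : G}
    (hw : w ∈ Subgroup.closure S) : ∃ g ∈ T, ∃ h ∈ H, w = g * h := by
  have key : ∀ s ∈ S, ∀ y, (∃ g ∈ T, ∃ h ∈ H, y = g * h) → ∃ g ∈ T, ∃ h ∈ H, s * y = g * h := by
    rintro s hs _ ⟨g, hg, h, hh, rfl⟩
    obtain ⟨g', hg', h', hh', e⟩ := hS s hs g hg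
    exact ⟨g', hg', h' * h, mul_mem hh' hh, by rw [← mul_assoc, e, mul_assoc]⟩
  induction hw using Subgroup.closure_induction_left with
  | one => exact ⟨1, h1, 1, one_mem _, by simp⟩
  | mul_left s hs y _ ih => exact key s hs y ih
  | inv_mul_cancel s hs y _ ih => rw [hinv s hs]; exact key s hs y ih

theorem eq_mul_mul_of_mul_pow_three_eq_one {G : Type*} [Group G] {x y : G} (hx : x * x = 1)
    (hy : y * y = 1) (h : (x * y) ^ 3 = 1) : x * y * x = y * x * y := by
  have hx' : x⁻¹ = x := inv_eq_of_mul_eq_one_left hx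
  have hy' : y⁻¹ = y := inv_eq_of_mul_eq_one_left hy
  have : x * y * x * (y * x * y) = 1 := by
    rw [← h]; simp only [pow_succ, pow_zero, one_mul, mul_assoc]
  rw [mul_eq_one_iff_eq_inv] at this
  rw [this]
  simp [hx', hy', mul_assoc]

theorem mul_comm_of_mul_pow_two_eq_one {G : Type*} [Group G] {x y : G} (hx : x * x = 1)
    (hy : y * y = 1) (h : (x * y) ^ 2 = 1) : x * y = y * x := by
  have hx' : x⁻¹ = x := inv_eq_of_mul_eq_one_left hx
  have hy' : y⁻¹ = y := inv_eq_of_mul_eq_one_left hy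
  rw [pow_two, mul_eq_one_iff_eq_inv] at h
  rw [h, mul_inv_rev, hx', hy']

open Equiv Equiv.Perm in
/-- A group that is generated by elements satisfying the relations of type `A` embeds into the
symmetric group. -/
theorem eq_one_of_typeA_relations {W α : Type*} [Group W] [DecidableEq α] (s : ℕ → W)
    (φ : W →* Perm α) (p : ℕ → α) (n : ℕ) (hp : ∀ i ≤ n, ∀ j ≤ n, p i = p j → i = j)
    (hφ : ∀ i < n, φ (s i) = swap (p i) (p (i + 1))) (hs : ∀ i < n, s i * s i = 1)
    (hcomm : ∀ i j, i + 1 < j → j < n → s i * s j = s j * s i)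
    (hbraid : ∀ i, i + 1 < n → s (i + 1) * s i * s (i + 1) = s i * s (i + 1) * s i)
    (k : ℕ) (hk : k ≤ n) : ∀ w ∈ Subgroup.closure (s '' {i | i < k}), φ w = 1 → w = 1 := by
  induction k with
  | zero => simp
  | succ k ih =>
    -- the coset representatives
    let g : ℕ → W := fun d => Nat.rec 1 (fun d x => s (k - d) * x) d
    have g0 : g 0 = 1 := rfl
    have gs : ∀ d, g (d + 1) = s (k - d) * g d := fun d => rfl
    -- Here $g_d=s_{k-d+1}\cdots s_k$. A generator $s_i$ far below this word commutes with it, and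
    -- one inside it passes through as $s_{i-1}$ by the braid relation. The two remaining values of
    -- $i$ lengthen or shorten the word.
    have hC1 : ∀ d ≤ k + 1, ∀ i, i + 1 < k + 1 - d → s i * g d = g d * s i := by
      intro d
      induction d with
      | zero => intro _ i _; simp [g0]
      | succ d ihd =>
        intro hd i hi
        rw [gs, ← mul_assoc, hcomm i (k - d) (by omega) (by omega), mul_assoc,
          ihd (by omega) i (by omega), mul_assoc]
    have hC2 : ∀ d ≤ k + 1, ∀ i, k + 1 - d < i → i ≤ k → s i * g d = g d * s (i - 1) := by
      intro d
      induction d with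
      | zero => intro _ i h1 h2; omega
      | succ d ihd =>
        intro hd i h1 h2
        rcases eq_or_ne i (k - d + 1) with h | h
        · obtain ⟨e, rfl⟩ : ∃ e, d = e + 1 := ⟨d - 1, by omega⟩
          obtain ⟨j, rfl⟩ : ∃ j, i = j + 1 := ⟨i - 1, by omega⟩
          have e1 : k - (e + 1) = j := by omega
          have e2 : k - e = j + 1 := by omega
          rw [gs, gs, e1, e2, Nat.add_sub_cancel, ← mul_assoc, ← mul_assoc,
            hbraid j (by omega), mul_assoc _ (s j), hC1 e (by omega) j (by omega)]
          simp only [mul_assoc]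
        · rw [gs, ← mul_assoc, ← hcomm (k - d) i (by omega) (by omega), mul_assoc,
            ihd (by omega) i (by omega) h2, mul_assoc]
    have hgp : ∀ d ≤ k + 1, φ (g d) (p (k + 1)) = p (k + 1 - d) := by
      intro d
      induction d with
      | zero => intro _; simp [g0]
      | succ d ihd =>
        intro hd
        have e1 : k - d + 1 = k + 1 - d := by omega
        rw [gs, map_mul, mul_apply, ihd (by omega), hφ _ (by omega), e1, swap_apply_right]
        congr 1
        omega
    have hfix : ∀ h ∈ Subgroup.closure (s '' {i | i < k}), φ h (p (k + 1)) = p (k + 1) := by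
      intro h hh
      induction hh using Subgroup.closure_induction with
      | mem x hx =>
        obtain ⟨i, hi, rfl⟩ := hx
        change i < k at hi
        rw [hφ i (by omega)]
        apply swap_apply_of_ne_of_ne
        · intro h
          have := hp (k + 1) hk i (by omega) h; omega
        · intro h
          have := hp (k + 1) hk (i + 1) (by omega) h; omega
      | one => simp
      | mul x y _ _ hx hy => rw [map_mul, mul_apply, hy, hx]
      | inv x _ hx => rw [map_inv, Perm.inv_eq_iff_eq, hx]
    have hcos : ∀ t ∈ s '' {i | i < k + 1}, ∀ x ∈ g '' {d | d ≤ k + 1},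
        ∃ x' ∈ g '' {d | d ≤ k + 1}, ∃ h ∈ Subgroup.closure (s '' {i | i < k}),
          t * x = x' * h := by
      rintro _ ⟨i, hi, rfl⟩ _ ⟨d, hd, rfl⟩
      change i < k + 1 at hi
      change d ≤ k + 1 at hd
      rcases lt_trichotomy i (k + 1 - d) with h | h | h
      · rcases eq_or_ne (i + 1) (k + 1 - d) with h' | h'
        · refine ⟨_, ⟨d + 1, (by change d + 1 ≤ k + 1; omega), rfl⟩, 1, one_mem _, ?_⟩
          rw [gs, mul_one]
          congr 2
          omega
        · refine ⟨_, ⟨d, hd, rfl⟩, s i, Subgroup.subset_closure ⟨i, ?_, rfl⟩,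
            hC1 d hd i (by omega)⟩
          change i < k
          omega
      · obtain ⟨e, rfl⟩ : ∃ e, d = e + 1 := ⟨d - 1, by omega⟩
        refine ⟨_, ⟨e, (by change e ≤ k + 1; omega), rfl⟩, 1, one_mem _, ?_⟩
        have e1 : k - e = i := by omega
        rw [gs, e1, ← mul_assoc, hs i (by omega), one_mul, mul_one]
      · refine ⟨_, ⟨d, hd, rfl⟩, s (i - 1), Subgroup.subset_closure ⟨i - 1, ?_, rfl⟩,
            hC2 d hd i h (by omega)⟩
        change i - 1 < k
        omega
    intro w hw hφw
    obtain ⟨_, ⟨d, hd, rfl⟩, h, hh, rfl⟩ := Subgroup.exists_eq_mul_of_mem_closure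
      (H := Subgroup.closure (s '' {i | i < k})) (T := g '' {d | d ≤ k + 1}) ⟨0, Nat.zero_le _, g0⟩ (by
        rintro _ ⟨i, hi, rfl⟩
        change i < k + 1 at hi
        exact inv_eq_of_mul_eq_one_left (hs i (by omega))) hcos hw
    change d ≤ k + 1 at hd
    -- The subgroup fixes $p_{k+1}$ while $g_d$ sends it to $p_{k+1-d}$, so a kernel element has
    -- trivial coset representative.
    have h1 := congrArg (fun σ : Perm α => σ (p (k + 1))) hφw
    simp only [map_mul, mul_apply, hfix h hh, hgp d hd, one_apply] at h1
    have h2 := hp _ (by omega) _ hk h1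
    obtain rfl : d = 0 := by omega
    rw [g0, one_mul] at hφw ⊢
    exact ih (by omega) h hh hφw

namespace CoxeterSystem

open Equiv Equiv.Perm

variable {B W : Type*} [Group W] {M : CoxeterMatrix B} (cs : CoxeterSystem M W)

theorem _root_.Equiv.swap_mul_swap_pow_three {α : Type*} [Fintype α] [DecidableEq α] {a b c : α}
    (hab : a ≠ b) (hac : a ≠ c) (hbc : b ≠ c) : (swap a b * swap b c) ^ 3 = 1 := by
  have h := isThreeCycle_swap_mul_swap_same hab.symm hbc hac
  rw [swap_comm b a] at h
  rw [← h.orderOf, pow_orderOf_eq_one]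

theorem isLiftable_swap {n : ℕ} {e : B ≃ Fin n} (h : M.reindex e = CoxeterMatrix.A n) :
    M.IsLiftable fun i => swap (e i).castSucc (e i).succ := by
  have key : ∀ i j : Fin n, i < j →
      (swap i.castSucc i.succ * swap j.castSucc j.succ) ^ CoxeterMatrix.A n i j = 1 := by
    intro i j hij
    rw [Fin.lt_def] at hij
    by_cases hs : (i : ℕ) + 1 = j
    · have : (CoxeterMatrix.A n) i j = 3 := by
        simp [CoxeterMatrix.A, hs, Fin.ext_iff, hij.ne]
      rw [this, show j.castSucc = i.succ from Fin.ext (by simp [hs])]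
      apply swap_mul_swap_pow_three <;> simp [Fin.ext_iff] <;> omega
    · have : (CoxeterMatrix.A n) i j = 2 := by
        simp [CoxeterMatrix.A, Fin.ext_iff, hij.ne, hs]; omega
      have hc : Commute (swap i.castSucc i.succ) (swap j.castSucc j.succ) := by
        rw [Commute, SemiconjBy, mul_swap_eq_swap_mul, swap_apply_of_ne_of_ne,
          swap_apply_of_ne_of_ne] <;> simp [Fin.ext_iff] <;> omega
      rw [this, hc.mul_pow, pow_two, pow_two, swap_mul_self, swap_mul_self, one_mul]
  intro i j
  have hM : M i j = CoxeterMatrix.A n (e i) (e j) := by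
    rw [← h, CoxeterMatrix.reindex_apply]; simp
  rw [hM]
  dsimp only
  generalize e i = i
  generalize e j = j
  rcases lt_trichotomy i j with hij | rfl | hij
  · exact key i j hij
  · simp
  · have := key j i hij
    rw [← inv_eq_one, ← inv_pow, mul_inv_rev, swap_inv, swap_inv] at this
    rwa [CoxeterMatrix.symmetric]

/-- A Coxeter group of type `A` is a symmetric group. -/
theorem exists_mulEquiv_perm {n : ℕ} {e : B ≃ Fin n} (h : M.reindex e = CoxeterMatrix.A n) :
    ∃ φ : W ≃* Perm (Fin (n + 1)),
      ∀ i, φ (cs.simple i) = swap (e i).castSucc (e i).succ := by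
  set φ := cs.lift ⟨_, isLiftable_swap h⟩ with hφdef
  have hφ : ∀ i, φ (cs.simple i) = swap (e i).castSucc (e i).succ :=
    cs.lift_apply_simple (isLiftable_swap h)
  have hM : ∀ i j, M (e.symm i) (e.symm j) = CoxeterMatrix.A n i j := by
    intro i j
    rw [← h, CoxeterMatrix.reindex_apply]
  refine ⟨MulEquiv.ofBijective φ ⟨?_, ?_⟩, hφ⟩
  · rw [injective_iff_map_eq_one]
    -- The value $1$ from $n$ on is never used.
    let s : ℕ → W := fun k => if hk : k < n then cs.simple (e.symm ⟨k, hk⟩) else 1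
    have hs : ∀ k (hk : k < n), s k = cs.simple (e.symm ⟨k, hk⟩) := fun k hk => dif_pos hk
    have hs1 : ∀ i < n, s i * s i = 1 := by
      intro i hi
      rw [hs i hi, simple_mul_simple_self]
    have hrel : ∀ i (hi : i < n) j (hj : j < n),
        (s i * s j) ^ CoxeterMatrix.A n ⟨i, hi⟩ ⟨j, hj⟩ = 1 := by
      intro i hi j hj
      rw [hs i hi, hs j hj, ← hM, simple_mul_simple_pow]
    have hall : ∀ w : W, w ∈ Subgroup.closure (s '' {i | i < n}) := by
      intro w
      have : Subgroup.closure (s '' {i | i < n}) = ⊤ := by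
        rw [eq_top_iff, ← cs.subgroup_closure_range_simple, Subgroup.closure_le]
        rintro _ ⟨i, rfl⟩
        apply Subgroup.subset_closure
        refine ⟨e i, (e i).2, ?_⟩
        rw [hs _ (e i).2]
        simp
      rw [this]
      trivial
    intro w hw
    refine eq_one_of_typeA_relations s φ (fun i => Fin.ofNat (n + 1) i) n ?_ ?_ hs1 ?_ ?_ n le_rfl
      w (hall w) hw
    · intro i hi j hj hij
      simpa [Fin.ext_iff, Nat.mod_eq_of_lt (Nat.lt_succ_of_le hi),
        Nat.mod_eq_of_lt (Nat.lt_succ_of_le hj)] using hij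
    · intro i hi
      rw [hs i hi, hφ, e.apply_symm_apply]
      congr 1
      · exact Fin.ext (Nat.mod_eq_of_lt (by omega)).symm
      · exact Fin.ext (Nat.mod_eq_of_lt (by omega)).symm
    · intro i j hij hj
      have := hrel i (by omega) j hj
      apply mul_comm_of_mul_pow_two_eq_one (hs1 i (by omega)) (hs1 j hj)
      have hA : CoxeterMatrix.A n ⟨i, by omega⟩ ⟨j, hj⟩ = 2 := by
        simp [CoxeterMatrix.A, show i ≠ j by omega, show ¬ (j + 1 = i ∨ i + 1 = j) by omega]
      rwa [hA] at this
    · intro i hi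
      have := hrel (i + 1) hi i (by omega)
      apply eq_mul_mul_of_mul_pow_three_eq_one (hs1 _ hi) (hs1 i (by omega))
      have hA : CoxeterMatrix.A n ⟨i + 1, hi⟩ ⟨i, by omega⟩ = 3 := by
        simp [CoxeterMatrix.A]
      rwa [hA] at this
  · rw [← MonoidHom.mrange_eq_top, eq_top_iff, ← mclosure_swap_castSucc_succ, Submonoid.closure_le]
    rintro _ ⟨i, rfl⟩
    exact ⟨cs.simple (e.symm i), by rw [hφ, e.apply_symm_apply]⟩

variable {cs}

theorem isReflection_iff_isSwap {n : ℕ} {e : B ≃ Fin n} {φ : W ≃* Perm (Fin (n + 1))}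
    (hφ : ∀ i, φ (cs.simple i) = swap (e i).castSucc (e i).succ) (w : W) :
    cs.IsReflection w ↔ φ w ∈ {t : Perm (Fin (n + 1)) | t.IsSwap} := by
  constructor
  · rintro ⟨v, i, rfl⟩
    rw [map_mul, map_mul, map_inv, hφ]
    exact IsSwap.conj ⟨_, _, Fin.castSucc_lt_succ.ne, rfl⟩ _
  · rintro ⟨x, y, hxy, h⟩
    have hn : 0 < n := by
      by_contra h0
      obtain rfl : n = 0 := by omega
      exact hxy (Fin.ext (by omega))
    have hc := isConj_swap (Fin.castSucc_lt_succ (i := (⟨0, hn⟩ : Fin n))).ne hxy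
    obtain ⟨g, hg⟩ := isConj_iff.1 hc
    refine ⟨φ.symm g, e.symm ⟨0, hn⟩, φ.injective ?_⟩
    rw [h, ← hg, map_mul, map_mul, map_inv, hφ, e.apply_symm_apply, φ.apply_symm_apply]

end CoxeterSystem

open Equiv Equiv.Perm

/-- The sum of the coordinates up to $i$ is $1$ on $e_i-e_{i+1}$ and $0$ on every other difference,
so it isolates the coefficient of index $i$. -/
theorem linearIndependent_single_castSucc_sub_single_succ (n : ℕ) :
    LinearIndependent ℝ fun i : Fin n =>
      (Pi.single i.castSucc 1 - Pi.single i.succ 1 : Fin (n + 1) → ℝ) := by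
  rw [Fintype.linearIndependent_iff]
  intro g hg i
  have h := congrArg (fun v : Fin (n + 1) → ℝ => ∑ j ∈ Finset.Iic i.castSucc, v j) hg
  simp only [Finset.sum_apply, Pi.smul_apply, Pi.sub_apply, smul_eq_mul, Pi.zero_apply,
    Finset.sum_const_zero] at h
  rw [Finset.sum_comm] at h
  simp only [← Finset.mul_sum, Finset.sum_sub_distrib, Finset.sum_pi_single', Finset.mem_Iic] at h
  rw [Finset.sum_eq_single i] at h
  · simpa [Fin.castSucc_lt_succ] using h
  · intro j _ hji
    have : (j.castSucc ≤ i.castSucc) ↔ (j.succ ≤ i.castSucc) := by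
      simp only [Fin.le_def, Fin.val_castSucc, Fin.val_succ]
      have : (j : ℕ) ≠ i := fun h => hji (Fin.ext h)
      omega
    simp [this]
  · simp

/-- The product of all adjacent transpositions, in any order, acts transitively. -/
theorem sameCycle_prod_swap {n : ℕ} {l : List (Fin n)} (hl : l.Nodup) (hmem : ∀ i, i ∈ l)
    (x y : Fin (n + 1)) : (l.map fun i => swap i.castSucc i.succ).prod.SameCycle x y := by
  classical
  set σ := (l.map fun i : Fin n => swap i.castSucc i.succ).prod with hσ
  -- The indicator of an orbit is fixed by the product, hence by every adjacent transposition, hence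
  -- constant.
  set v : Fin (n + 1) → ℝ := fun z => if σ.SameCycle x z then 1 else 0 with hv
  have hprod : ∀ (l : List (Fin n)) (v : Fin (n + 1) → ℝ),
      (l.map fun i => LinearMap.funLeft ℝ ℝ (swap i.castSucc i.succ)).prod v =
        v ∘ ((l.map fun i => swap i.castSucc i.succ).prod⁻¹ : Perm (Fin (n + 1))) := by
    intro l v
    induction l with
    | nil => simp
    | cons i l ih =>
      rw [List.map_cons, List.prod_cons, Module.End.mul_apply, ih]
      ext z
      simp [LinearMap.funLeft_apply]
  have hfix := (linearIndependent_single_castSucc_sub_single_succ n).apply_eq_self_of_prod_apply_eq_self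
    (s := fun i => LinearMap.funLeft ℝ ℝ (swap i.castSucc i.succ)) (v := v) (by
      intro i v
      rw [Submodule.mem_span_singleton]
      refine ⟨v i.succ - v i.castSucc, ?_⟩
      ext z
      rcases eq_or_ne z i.castSucc with rfl | h1
      · simp [LinearMap.funLeft_apply, Fin.castSucc_lt_succ.ne]
      · rcases eq_or_ne z i.succ with rfl | h2
        · simp [LinearMap.funLeft_apply, Fin.castSucc_lt_succ.ne']
        · simp [LinearMap.funLeft_apply, swap_apply_of_ne_of_ne h1 h2, h1, h2]) l hl (by
      rw [hprod]
      ext z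
      simp only [Function.comp_apply, hv, ← hσ]
      exact if_congr sameCycle_symm_apply_right rfl rfl)
  have hconst : ∀ z, v z = v 0 := by
    intro z
    induction z using Fin.induction with
    | zero => rfl
    | succ i ih =>
      rw [← ih]
      have := congrFun (hfix i (hmem i)) i.castSucc
      simpa [LinearMap.funLeft_apply] using this
  have h1 : v y = v x := (hconst y).trans (hconst x).symm
  by_contra h
  simp [hv, h, SameCycle.refl] at h1

/-- Both products act transitively, so for $n>0$ both are cycles through all points. -/
theorem isConj_prod_swap {n : ℕ} {l l' : List (Fin n)} (hl : l.Nodup) (hmem : ∀ i, i ∈ l)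
    (hl' : l'.Nodup) (hmem' : ∀ i, i ∈ l') :
    IsConj (l.map fun i => swap i.castSucc i.succ).prod
      (l'.map fun i => swap i.castSucc i.succ).prod := by
  rcases Nat.eq_zero_or_pos n with rfl | hn
  · rw [show (l.map fun i => swap i.castSucc i.succ).prod =
      (l'.map fun i => swap i.castSucc i.succ).prod from Equiv.ext fun _ => Fin.ext (by omega)]
  · have key : ∀ σ : Perm (Fin (n + 1)), (∀ x y, σ.SameCycle x y) →
        σ.IsCycle ∧ σ.support = Finset.univ := by
      intro σ hσ
      have hne : ∀ x, σ x ≠ x := by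
        intro x hx
        have : Nontrivial (Fin (n + 1)) := Fin.nontrivial_iff_two_le.2 (by omega)
        obtain ⟨y, hy⟩ := exists_ne x
        exact hy ((hσ x y).eq_of_left hx).symm
      exact ⟨⟨0, hne 0, fun y _ => hσ 0 y⟩, by ext x; simp [hne]⟩
    obtain ⟨h1, h2⟩ := key _ (sameCycle_prod_swap hl hmem)
    obtain ⟨h1', h2'⟩ := key _ (sameCycle_prod_swap hl' hmem')
    exact h1.isConj h1' (by rw [h2, h2'])

/-- The points `0, 1, …, n` as a sequence. -/
theorem adjacentSwaps_ofNat (n : ℕ) :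
    adjacentSwaps (fun i => Fin.ofNat (n + 1) i) n =
      (List.finRange n).map fun i => swap i.castSucc i.succ := by
  rw [adjacentSwaps, ← List.map_coe_finRange_eq_range, List.map_map]
  refine List.map_congr_left fun i _ => ?_
  simp only [Function.comp_apply]
  congr 1
  · exact Fin.ext (Nat.mod_eq_of_lt (by omega))
  · exact Fin.ext (Nat.mod_eq_of_lt (by omega))

namespace CoxeterSystem

variable {B W : Type*} [Group W] {M : CoxeterMatrix B} {cs : CoxeterSystem M W}

theorem isConj_adjacentSwaps {n : ℕ} {e : B ≃ Fin n} {φ : W ≃* Perm (Fin (n + 1))}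
    (hφ : ∀ i, φ (cs.simple i) = swap (e i).castSucc (e i).succ) {c : W}
    (hc : cs.IsCoxeterElement c) :
    IsConj (φ c) (adjacentSwaps (fun i => Fin.ofNat (n + 1) i) n).prod := by
  obtain ⟨l, hl, hmem, hlc⟩ := hc
  have h1 : φ (cs.wordProd l) = ((l.map e).map fun i => swap i.castSucc i.succ).prod := by
    rw [wordProd, map_list_prod, List.map_map, List.map_map]
    congr 1
    exact List.map_congr_left fun i _ => hφ i
  have h2 : IsConj (φ (cs.wordProd l)) (φ c) := φ.toMonoidHom.map_isConj hlc
  refine h2.symm.trans ?_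
  rw [h1, adjacentSwaps_ofNat]
  refine isConj_prod_swap (hl.map e.injective) (fun i => ?_) (List.nodup_finRange n)
    (List.mem_finRange)
  rw [List.mem_map]
  exact ⟨e.symm i, hmem _, e.apply_symm_apply i⟩

theorem radius_hurwitzGraph_of_typeA [Fintype B] [Finite W] {c : W}
    (hc : cs.IsCoxeterElement c) {n : ℕ} (hM : M.HasType (CoxeterMatrix.A n)) :
    (cs.hurwitzGraph c).radius ≤ n.choose 2 := by
  obtain ⟨e, he⟩ := hM
  obtain ⟨φ, hφ⟩ := cs.exists_mulEquiv_perm he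
  have hcard : Fintype.card B = n := by simpa using Fintype.card_congr e
  have hd := isConj_adjacentSwaps hφ hc
  obtain ⟨f⟩ := cs.nonempty_factorizationGraph_iso_hurwitzGraph hc φ
    (isReflection_iff_isSwap hφ) hd hcard
  rw [f.radius_eq]
  have hinj : ∀ i ≤ n, ∀ j ≤ n, Fin.ofNat (n + 1) i = Fin.ofNat (n + 1) j → i = j := by
    intro i hi j hj hij
    simpa [Fin.ext_iff, Nat.mod_eq_of_lt (Nat.lt_succ_of_le hi),
      Nat.mod_eq_of_lt (Nat.lt_succ_of_le hj)] using hij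
  let u : Factorization {t : Perm (Fin (n + 1)) | t.IsSwap} n
      (adjacentSwaps (fun i => Fin.ofNat (n + 1) i) n).prod :=
    ⟨_, by simp [adjacentSwaps], by
      intro t ht
      obtain ⟨i, hi, rfl⟩ := List.mem_map.1 ht
      rw [List.mem_range] at hi
      refine ⟨_, _, fun h => ?_, rfl⟩
      have := hinj i (by omega) (i + 1) (by omega) h
      omega, rfl⟩
  refine (SimpleGraph.radius_le_eccent (u := u)).trans ?_
  rw [SimpleGraph.eccent_le_iff]
  intro v
  rw [SimpleGraph.edist_comm]
  apply HurwitzReach.edist_le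
  apply hurwitzReach_adjacentSwaps _ _ hinj _ v.2.2.1 v.2.1 v.2.2.2
  intro m hm hmv
  exact hcard ▸ cs.le_length_of_isConj hc φ (isReflection_iff_isSwap hφ) hd hm
    (hmv.trans v.2.2.2)

end CoxeterSystem

/-! ### Distances in finite graphs by computation with bit masks -/

/-- `force f n = f n`, where the kernel evaluates `n` before it enters `f`. -/
def force {α : Type*} (f : ℕ → α) (n : ℕ) : α := Nat.casesOn n (f 0) fun k => f (k + 1)

theorem force_eq {α : Type*} (f : ℕ → α) (n : ℕ) : force f n = f n := by cases n <;> rfl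

/-- `forceList f l = f l`, where the members of `l` are evaluated first. -/
def forceList {α : Type*} : (List ℕ → α) → List ℕ → α
  | f, [] => f []
  | f, a :: l => force (fun a => forceList (fun l => f (a :: l)) l) a

theorem forceList_eq {α : Type*} (f : List ℕ → α) (l : List ℕ) : forceList f l = f l := by
  induction l generalizing f with
  | nil => rfl
  | cons a l ih => rw [forceList, force_eq, ih]

/-- `forceLists f l = f l`, where the members of the members of `l` are evaluated first. -/
def forceLists {α : Type*} : (List (List ℕ) → α) → List (List ℕ) → α
  | f, [] => f []
  | f, a :: l => forceList (fun a => forceLists (fun l => f (a :: l)) l) a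

theorem forceLists_eq {α : Type*} (f : List (List ℕ) → α) (l : List (List ℕ)) :
    forceLists f l = f l := by
  induction l generalizing f with
  | nil => rfl
  | cons a l ih => rw [forceLists, forceList_eq, ih]

/-- The union of the masks `ms i` over the elements `i` of the mask `b`. -/
def maskUnion : List ℕ → ℕ → ℕ
  | [], _ => 0
  | m :: ms, b => bif Nat.beq (Nat.mod b 2) 1 then Nat.lor m (maskUnion ms (Nat.div b 2))
    else maskUnion ms (Nat.div b 2)

theorem testBit_maskUnion (ms : List ℕ) (b j : ℕ) :
    (maskUnion ms b).testBit j ↔ ∃ (i : ℕ) (h : i < ms.length), b.testBit i ∧ ms[i].testBit j := by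
  induction ms generalizing b with
  | nil => simp [maskUnion]
  | cons m ms ih =>
    have hsplit : (∃ (i : ℕ) (h : i < (m :: ms).length), b.testBit i ∧ (m :: ms)[i].testBit j) ↔
        (b.testBit 0 ∧ m.testBit j) ∨
          ∃ (i : ℕ) (h : i < ms.length), (b / 2).testBit i ∧ ms[i].testBit j := by
      constructor
      · rintro ⟨i, h, h1, h2⟩
        cases i with
        | zero => exact .inl ⟨h1, h2⟩
        | succ i =>
          rw [Nat.testBit_succ] at h1
          exact .inr ⟨i, by simpa using h, h1, by simpa using h2⟩
      · rintro (⟨h1, h2⟩ | ⟨i, h, h1, h2⟩)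
        · exact ⟨0, by simp, h1, h2⟩
        · exact ⟨i + 1, by simpa using h, by rwa [Nat.testBit_succ], by simpa using h2⟩
    rw [hsplit, maskUnion, Nat.testBit_zero, ← ih]
    change (bif Nat.beq (b % 2) 1 then m ||| maskUnion ms (b / 2) else
      maskUnion ms (b / 2)).testBit j = true ↔ _
    rcases Nat.mod_two_eq_zero_or_one b with hb | hb <;> rw [hb] <;> simp [Nat.beq]

/-- The ball of radius `k` around the set `b`, where `ms` are the masks of the neighborhoods. -/
def maskBall (ms : List ℕ) : ℕ → ℕ → ℕ
  | 0, b => b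
  | k + 1, b => force (maskBall ms k) (b ||| maskUnion ms b)

/-- `ms` are the masks of the neighborhoods of the graph `G`, whose vertices are numbered
by `f`. -/
structure SimpleGraph.IsMask {V : Type*} (G : SimpleGraph V) (ms : List ℕ)
    (f : Fin ms.length → V) : Prop where
  bijective : Function.Bijective f
  lt : ∀ i : Fin ms.length, ms[i] < 2 ^ ms.length
  adj : ∀ i j : Fin ms.length, ms[i].testBit j ↔ G.Adj (f i) (f j)

namespace SimpleGraph.IsMask

variable {V : Type*} {G : SimpleGraph V} {ms : List ℕ} {f : Fin ms.length → V}

theorem lt_of_testBit_maskUnion (h : G.IsMask ms f) {b j : ℕ}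
    (hj : (maskUnion ms b).testBit j) : j < ms.length := by
  obtain ⟨i, hi, -, h1⟩ := (testBit_maskUnion _ _ _).1 hj
  by_contra hlt
  push Not at hlt
  have := Nat.testBit_lt_two_pow ((h.lt ⟨i, hi⟩).trans_le (Nat.pow_le_pow_right two_pos hlt))
  exact absurd h1 (by simpa using this)

theorem lt_of_testBit_maskBall (h : G.IsMask ms f) {k b j : ℕ}
    (hb : ∀ j, b.testBit j → j < ms.length) (hj : (maskBall ms k b).testBit j) :
    j < ms.length := by
  induction k generalizing b with
  | zero => exact hb j hj
  | succ k ih =>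
    rw [maskBall, force_eq] at hj
    refine ih (fun i hi => ?_) hj
    rw [Nat.testBit_or, Bool.or_eq_true] at hi
    rcases hi with hi | hi
    · exact hb i hi
    · exact h.lt_of_testBit_maskUnion hi

theorem edist_le_of_testBit (h : G.IsMask ms f) {k b : ℕ} {u : V} {d : ℕ}
    (hb : ∀ j : Fin ms.length, b.testBit j → G.edist u (f j) ≤ d) {j : Fin ms.length}
    (hj : (maskBall ms k b).testBit j) : G.edist u (f j) ≤ (d + k : ℕ) := by
  induction k generalizing b d with
  | zero => exact hb j hj
  | succ k ih =>
    rw [maskBall, force_eq] at hj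
    rw [show d + (k + 1) = d + 1 + k by ring]
    refine ih (fun i hi => ?_) hj
    rw [Nat.testBit_or, Bool.or_eq_true] at hi
    rcases hi with hi | hi
    · exact (hb i hi).trans (by exact_mod_cast Nat.le_succ d)
    · obtain ⟨a, ha, h1, h2⟩ := (testBit_maskUnion _ _ _).1 hi
      have hadj := (h.adj ⟨a, ha⟩ i).1 h2
      refine (SimpleGraph.edist_triangle (v := f ⟨a, ha⟩)).trans ?_
      rw [Nat.cast_add]
      exact add_le_add (hb ⟨a, ha⟩ h1) (SimpleGraph.edist_eq_one_iff_adj.2 hadj).le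

theorem testBit_maskBall_of_testBit {k b j : ℕ} (hj : b.testBit j) :
    (maskBall ms k b).testBit j := by
  induction k generalizing b with
  | zero => exact hj
  | succ k ih =>
    rw [maskBall, force_eq]
    exact ih (by rw [Nat.testBit_or, hj, Bool.true_or])

theorem testBit_maskBall_of_walk (h : G.IsMask ms f) {k b : ℕ} {u v : V} (p : G.Walk u v)
    (hp : p.length ≤ k) {i j : Fin ms.length} (hi : f i = u) (hj : f j = v) (hb : b.testBit i) :
    (maskBall ms k b).testBit j := by
  induction p generalizing b k i with
  | nil =>
    obtain rfl := h.bijective.1 (hi.trans hj.symm)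
    exact testBit_maskBall_of_testBit hb
  | @cons u w v hadj p ih =>
    rw [SimpleGraph.Walk.length_cons] at hp
    obtain ⟨a, rfl⟩ := h.bijective.2 w
    obtain ⟨k, rfl⟩ : ∃ k', k = k' + 1 := ⟨k - 1, by omega⟩
    rw [maskBall, force_eq]
    refine ih (by omega) rfl hj ?_
    rw [Nat.testBit_or, Bool.or_eq_true]
    right
    rw [testBit_maskUnion]
    subst hi
    exact ⟨i, i.2, hb, (h.adj i a).2 hadj⟩

theorem lt_of_testBit_two_pow {N : ℕ} (i : Fin N) (j : ℕ) (hj : (2 ^ (i : ℕ)).testBit j) :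
    j < N := by
  rw [Nat.testBit_two_pow] at hj
  have := of_decide_eq_true hj
  omega

theorem eccent_le (h : G.IsMask ms f) {i : Fin ms.length} {k : ℕ}
    (hk : maskBall ms k (2 ^ (i : ℕ)) = 2 ^ ms.length - 1) : G.eccent (f i) ≤ k := by
  rw [SimpleGraph.eccent_le_iff]
  intro v
  obtain ⟨j, rfl⟩ := h.bijective.2 v
  have := h.edist_le_of_testBit (k := k) (b := 2 ^ (i : ℕ)) (u := f i) (d := 0) (j := j) ?_ ?_
  · simpa using this
  · intro j hj
    rw [Nat.testBit_two_pow] at hj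
    obtain rfl : i = j := Fin.ext (of_decide_eq_true hj)
    simp
  · rw [hk, Nat.testBit_two_pow_sub_one]
    simp

/-- If every vertex were within distance $k$, all bits below the number of vertices would be set,
and the bound on the masks excludes any further bit. -/
theorem exists_lt_edist (h : G.IsMask ms f) {i : Fin ms.length} {k : ℕ}
    (hk : maskBall ms k (2 ^ (i : ℕ)) ≠ 2 ^ ms.length - 1) :
    ∃ v, (k : ℕ∞) < G.edist (f i) v := by
  by_contra! hall
  apply hk
  apply Nat.eq_of_testBit_eq
  intro j
  rw [Nat.testBit_two_pow_sub_one, Bool.eq_iff_iff, decide_eq_true_iff]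
  refine ⟨fun hj => h.lt_of_testBit_maskBall (lt_of_testBit_two_pow i) hj, fun hj => ?_⟩
  have h1 := hall (f ⟨j, hj⟩)
  have htop : G.edist (f i) (f ⟨j, hj⟩) ≠ ⊤ := (h1.trans_lt (ENat.natCast_lt_top k)).ne
  obtain ⟨p, hp⟩ := SimpleGraph.exists_walk_of_edist_ne_top htop
  rw [← hp] at h1
  exact h.testBit_maskBall_of_walk (j := ⟨j, hj⟩) p (by exact_mod_cast h1) rfl rfl (by simp)

/-- All eccentricities are at most `k`. -/
theorem ediam_le (h : G.IsMask ms f) {k : ℕ} (hk : ((List.range ms.length).all fun i =>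
    maskBall ms k (2 ^ i) == 2 ^ ms.length - 1) = true) : G.ediam ≤ k := by
  rw [SimpleGraph.ediam, iSup_le_iff]
  intro v
  obtain ⟨i, rfl⟩ := h.bijective.2 v
  rw [List.all_eq_true] at hk
  exact h.eccent_le (by simpa using hk i (by simp))

theorem lt_ediam (h : G.IsMask ms f) {k : ℕ} (hk : ((List.range ms.length).all fun i =>
    maskBall ms k (2 ^ i) == 2 ^ ms.length - 1) = false) : (k : ℕ∞) < G.ediam := by
  rw [List.all_eq_false] at hk
  obtain ⟨i, hi, hk⟩ := hk
  rw [List.mem_range] at hi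
  obtain ⟨v, hv⟩ := h.exists_lt_edist (i := ⟨i, hi⟩) (k := k) (by simpa using hk)
  exact hv.trans_le SimpleGraph.edist_le_ediam

theorem radius_le (h : G.IsMask ms f) {k : ℕ} (hk : ((List.range ms.length).any fun i =>
    maskBall ms k (2 ^ i) == 2 ^ ms.length - 1) = true) : G.radius ≤ k := by
  rw [List.any_eq_true] at hk
  obtain ⟨i, hi, hk⟩ := hk
  rw [List.mem_range] at hi
  exact SimpleGraph.radius_le_eccent.trans (h.eccent_le (i := ⟨i, hi⟩) (by simpa using hk))

end SimpleGraph.IsMask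

/-! ### Enumeration of factorizations -/

/-- The list of the factorizations of `c` into `k` members of `R`. -/
def factorizations {G : Type*} [Group G] [DecidableEq G] (R : List G) : ℕ → G → List (List G)
  | 0, c => if c = 1 then [[]] else []
  | k + 1, c => R.flatMap fun t => (factorizations R k (t⁻¹ * c)).map (t :: ·)

theorem mem_factorizations {G : Type*} [Group G] [DecidableEq G] {R : List G} {k : ℕ} {c : G}
    {l : List G} :
    l ∈ factorizations R k c ↔ l.length = k ∧ (∀ t ∈ l, t ∈ R) ∧ l.prod = c := by
  induction k generalizing c l with
  | zero =>
    rw [factorizations, List.length_eq_zero_iff]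
    split_ifs with h
    · simp only [List.mem_singleton]
      constructor
      · rintro rfl; simp [h]
      · exact fun h => h.1
    · simp only [List.not_mem_nil, false_iff, not_and]
      rintro rfl - rfl
      exact h rfl
  | succ k ih =>
    simp only [factorizations, List.mem_flatMap, List.mem_map, ih]
    constructor
    · rintro ⟨t, ht, l, ⟨h1, h2, h3⟩, rfl⟩
      refine ⟨by simp [h1], ?_, by simp [h3]⟩
      simpa [ht] using h2
    · rintro ⟨h1, h2, rfl⟩
      cases l with
      | nil => simp at h1
      | cons t l =>
        simp only [List.length_cons, List.mem_cons, forall_eq_or_imp, Nat.add_right_cancel_iff]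
          at h1 h2
        exact ⟨t, h2.1, l, ⟨h1, h2.2, by simp⟩, rfl⟩

theorem nodup_factorizations {G : Type*} [Group G] [DecidableEq G] {R : List G} (hR : R.Nodup)
    (k : ℕ) (c : G) : (factorizations R k c).Nodup := by
  induction k generalizing c with
  | zero => rw [factorizations]; split_ifs <;> simp
  | succ k ih =>
    rw [factorizations, List.nodup_flatMap]
    refine ⟨fun t _ => (ih _).map (List.cons_injective), hR.imp ?_⟩
    intro s t hst l hs ht
    obtain ⟨l, -, rfl⟩ := List.mem_map.1 hs
    obtain ⟨m, -, h⟩ := List.mem_map.1 ht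
    exact hst (List.cons.inj h).1.symm

/-- Two lists of equal lengths differ in exactly one place. -/
def List.differOnce : List ℕ → List ℕ → Bool
  | a :: l, b :: m => bif Nat.beq a b then differOnce l m else l == m
  | _, _ => false

theorem List.differOnce_iff {l m : List ℕ} (h : l.length = m.length) :
    List.differOnce l m ↔ ∃! i : ℕ, l[i]? ≠ m[i]? := by
  induction l generalizing m with
  | nil =>
    obtain rfl := List.length_eq_zero_iff.1 h.symm
    simp [differOnce, ExistsUnique]
  | cons a l ih =>
    match m, h with
    | b :: m, h =>
      rw [differOnce]
      by_cases hab : a = b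
      · subst hab
        rw [Nat.beq_refl, cond_true, ih (by simpa using h)]
        constructor
        · rintro ⟨i, hi, hu⟩
          refine ⟨i + 1, by simpa using hi, ?_⟩
          intro j hj
          cases j with
          | zero => simp at hj
          | succ j => rw [hu j (by simpa using hj)]
        · rintro ⟨i, hi, hu⟩
          cases i with
          | zero => simp at hi
          | succ i =>
            refine ⟨i, by simpa using hi, fun j hj => ?_⟩
            have := hu (j + 1) (by simpa using hj)
            omega
      · rw [show Nat.beq a b = false by simpa [← Bool.not_eq_true] using hab, cond_false,
          beq_iff_eq]
        constructor
        · rintro rfl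
          refine ⟨0, by simpa using hab, ?_⟩
          intro j hj
          cases j with
          | zero => rfl
          | succ j => simp at hj
        · rintro ⟨i, hi, hu⟩
          have h0 := hu 0 (by simpa using hab)
          apply List.ext_getElem?
          intro j
          by_contra hj
          have := hu (j + 1) (by simpa using hj)
          omega

/-- The mask of the lists in the family that differ from `k` in exactly one place. -/
def neighborMask (k : List ℕ) : List (List ℕ) → ℕ
  | [] => 0
  | m :: L => (k.differOnce m).toNat + 2 * neighborMask k L

theorem testBit_neighborMask (k : List ℕ) (L : List (List ℕ)) (j : ℕ) (hj : j < L.length) :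
    (neighborMask k L).testBit j = k.differOnce L[j] := by
  induction L generalizing j with
  | nil => simp at hj
  | cons m L ih =>
    cases j with
    | zero =>
      rw [neighborMask, Nat.testBit_zero]
      cases h : k.differOnce m <;> simp [h]
    | succ j =>
      rw [neighborMask, Nat.testBit_succ]
      have : ((k.differOnce m).toNat + 2 * neighborMask k L) / 2 = neighborMask k L := by
        have := Bool.toNat_lt (k.differOnce m)
        omega
      rw [this, ih j (by simpa using hj)]
      simp

theorem neighborMask_lt (k : List ℕ) (L : List (List ℕ)) :
    neighborMask k L < 2 ^ L.length := by
  induction L with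
  | nil => simp [neighborMask]
  | cons m L ih =>
    have := Bool.toNat_lt (k.differOnce m)
    rw [neighborMask, List.length_cons, pow_succ]
    omega

namespace Equiv.Perm

/-- A number that determines a permutation. -/
def code {n : ℕ} (σ : Perm (Fin n)) : ℕ :=
  (List.finRange n).foldr (fun i a => (σ i : ℕ) + n * a) 0

theorem code_injective {n : ℕ} : Function.Injective (code (n := n)) := by
  intro σ τ h
  have key : ∀ l : List (Fin n), l.foldr (fun i a => (σ i : ℕ) + n * a) 0 =
      l.foldr (fun i a => (τ i : ℕ) + n * a) 0 → ∀ i ∈ l, σ i = τ i := by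
    intro l
    induction l with
    | nil => simp
    | cons i l ih =>
      intro h
      rw [List.foldr_cons, List.foldr_cons] at h
      have h1 := congrArg (· % n) h
      have h2 := congrArg (· / n) h
      have hn : 0 < n := i.pos
      simp only [Nat.add_mul_mod_self_left, Nat.mod_eq_of_lt (Fin.isLt _),
        Nat.add_mul_div_left _ _ hn, Nat.div_eq_of_lt (Fin.isLt _), zero_add] at h1 h2
      intro j hj
      rcases List.mem_cons.1 hj with rfl | hj
      · exact Fin.ext h1
      · exact ih h2 j hj
  exact Equiv.ext fun i => key _ h i (List.mem_finRange i)

/-- The codes of the partial products of a factorization. -/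
def partialCodes {n : ℕ} (k : ℕ) (l : List (Perm (Fin n))) : List ℕ :=
  (List.range k).map fun i => code (l.take i).prod

/-- The neighborhoods of the graph of factorizations. -/
def factorizationMasks {n : ℕ} (R : List (Perm (Fin n))) (k : ℕ) (c : Perm (Fin n)) : List ℕ :=
  ((factorizations R k c).map (partialCodes k)).map fun l =>
    neighborMask l ((factorizations R k c).map (partialCodes k))

/-- Evaluates `p` at the masks of the graph of factorizations. -/
def evalMasks {n : ℕ} (R : List (Perm (Fin n))) (k : ℕ) (c : Perm (Fin n))
    (p : List ℕ → Bool) : Bool :=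
  forceLists (fun K => forceList p (K.map fun l => neighborMask l K))
    ((factorizations R k c).map (partialCodes k))

theorem evalMasks_eq {n : ℕ} (R : List (Perm (Fin n))) (k : ℕ) (c : Perm (Fin n))
    (p : List ℕ → Bool) : evalMasks R k c p = p (factorizationMasks R k c) := by
  rw [evalMasks, forceLists_eq, forceList_eq, factorizationMasks]

theorem length_factorizationMasks {n : ℕ} (R : List (Perm (Fin n))) (k : ℕ) (c : Perm (Fin n)) :
    (factorizationMasks R k c).length = (factorizations R k c).length := by
  simp [factorizationMasks]

theorem getElem_factorizationMasks {n : ℕ} (R : List (Perm (Fin n))) (k : ℕ) (c : Perm (Fin n))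
    (i : ℕ) (h : i < (factorizationMasks R k c).length) (h' : i < (factorizations R k c).length) :
    (factorizationMasks R k c)[i] = neighborMask (partialCodes k (factorizations R k c)[i])
      ((factorizations R k c).map (partialCodes k)) := by
  simp [factorizationMasks]

theorem exists_isMask {n : ℕ} {R : List (Perm (Fin n))} (hR : R.Nodup) (k : ℕ)
    (c : Perm (Fin n)) :
    ∃ f, (factorizationGraph {t | t ∈ R} k c).IsMask (factorizationMasks R k c) f := by
  have hlen := length_factorizationMasks R k c
  refine ⟨fun i => ⟨(factorizations R k c)[i.1]'(hlen ▸ i.2),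
    mem_factorizations.1 (List.getElem_mem _)⟩, ⟨?_, ?_⟩, ?_, ?_⟩
  · intro i j h
    exact Fin.ext ((nodup_factorizations hR k c).getElem_inj_iff.1 (congrArg Subtype.val h))
  · rintro ⟨l, hl⟩
    obtain ⟨i, hi, h⟩ := List.getElem_of_mem (mem_factorizations.2 hl)
    exact ⟨⟨i, hlen ▸ hi⟩, Subtype.ext h⟩
  · intro i
    refine (getElem_factorizationMasks R k c i.1 i.2 (hlen ▸ i.2)).trans_lt ?_
    exact (neighborMask_lt _ _).trans_eq (by rw [List.length_map, hlen])
  · intro i j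
    set l := (factorizations R k c)[i.1]'(hlen ▸ i.2) with hl
    set m := (factorizations R k c)[j.1]'(hlen ▸ j.2) with hm
    have hl' := mem_factorizations.1 (List.getElem_mem (hlen ▸ i.2) : l ∈ _)
    have hm' := mem_factorizations.1 (List.getElem_mem (hlen ▸ j.2) : m ∈ _)
    have h1 : (factorizationMasks R k c)[i] =
        neighborMask (partialCodes k l) ((factorizations R k c).map (partialCodes k)) :=
      getElem_factorizationMasks R k c i.1 i.2 (hlen ▸ i.2)
    rw [h1, testBit_neighborMask _ _ _ (by simpa using hlen ▸ j.2), List.getElem_map,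
      List.differOnce_iff (by simp [partialCodes])]
    change _ ↔ ∃! i : ℕ, (l.take i).prod ≠ (m.take i).prod
    refine existsUnique_congr fun a => not_congr ?_
    rw [partialCodes, partialCodes, List.getElem?_map, List.getElem?_map]
    -- The code lists stop before index $k$, from which on all partial products equal $c$.
    rcases lt_or_ge a k with ha | ha
    · rw [List.getElem?_range ha, Option.map_some, Option.map_some, Option.some_inj,
        code_injective.eq_iff]
    · rw [List.getElem?_eq_none (by simpa using ha), Option.map_none, Option.map_none,
        List.take_of_length_le (hl'.1.trans_le ha), List.take_of_length_le (hm'.1.trans_le ha),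
        hl'.2.2, hm'.2.2]
      simp

/-- The transpositions of `Fin n`. -/
def swaps (n : ℕ) : List (Perm (Fin n)) :=
  (List.finRange n).flatMap fun i => ((List.finRange n).filter (i < ·)).map fun j => swap i j

theorem mem_swaps {n : ℕ} {t : Perm (Fin n)} : t ∈ swaps n ↔ t.IsSwap := by
  simp only [swaps, List.mem_flatMap, List.mem_map, List.mem_filter, List.mem_finRange,
    true_and, decide_eq_true_iff, IsSwap]
  constructor
  · rintro ⟨i, j, hij, rfl⟩
    exact ⟨i, j, hij.ne, rfl⟩
  · rintro ⟨i, j, hij, rfl⟩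
    rcases lt_or_gt_of_ne hij with h | h
    · exact ⟨i, j, h, rfl⟩
    · exact ⟨j, i, h, swap_comm _ _⟩

end Equiv.Perm

/-! ### Computed balls in types $A_3$, $A_4$ and $B_3$. -/

namespace Equiv.Perm

set_option maxRecDepth 100000 in
-- Only the upper bound is computed; the lower bound for the diameter is that for the radius.
theorem evalMasks_swaps_four : evalMasks (swaps (3 + 1)) 3
    (adjacentSwaps (fun i => Fin.ofNat (3 + 1) i) 3).prod (fun ms =>
      (List.range ms.length).all fun i => maskBall ms 3 (2 ^ i) == 2 ^ ms.length - 1) = true := by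
  decide +kernel

set_option maxRecDepth 100000 in
theorem evalMasks_swaps_five : evalMasks (swaps (4 + 1)) 4
    (adjacentSwaps (fun i => Fin.ofNat (4 + 1) i) 4).prod (fun ms =>
      ((List.range ms.length).all fun i => maskBall ms 7 (2 ^ i) == 2 ^ ms.length - 1) &&
      !((List.range ms.length).all fun i => maskBall ms 6 (2 ^ i) == 2 ^ ms.length - 1)) =
        true := by
  decide +kernel

/-- The simple reflections of the Coxeter group of type `B₃`, as permutations of the six vectors
`±eᵢ`. -/
def signedSimple : Fin 3 → Perm (Fin 6) :=
  ![swap 0 1 * swap 3 4, swap 1 2 * swap 4 5, swap 2 5]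

/-- The nine reflections of type `B₃`, each as a conjugate of a simple reflection. -/
def signedReflectionWords : List (List (Fin 3) × Fin 3) :=
  [([], 0), ([], 1), ([], 2), ([0], 1), ([1], 2), ([0, 1], 2), ([2], 1), ([0, 2], 1),
    ([1, 0, 2], 1)]

/-- The nine reflections of type `B₃`. -/
def signedReflections : List (Perm (Fin 6)) :=
  signedReflectionWords.map fun p =>
    (p.1.map signedSimple).prod * signedSimple p.2 * ((p.1.map signedSimple).prod)⁻¹

theorem nodup_signedReflections : signedReflections.Nodup := by decide +kernel

theorem signedSimple_mem (i : Fin 3) : signedSimple i ∈ signedReflections := by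
  revert i; decide +kernel

theorem conj_signedSimple_mem (i : Fin 3) : ∀ t ∈ signedReflections,
    signedSimple i * t * (signedSimple i)⁻¹ ∈ signedReflections := by
  revert i; decide +kernel

theorem nodup_swaps_four : (swaps (3 + 1)).Nodup := by decide +kernel

theorem nodup_swaps_five : (swaps (4 + 1)).Nodup := by decide +kernel

set_option maxRecDepth 100000 in
theorem evalMasks_signedReflections : evalMasks signedReflections 3
    (([0, 1, 2].map signedSimple).prod) (fun ms =>
      ((List.range ms.length).any fun i => maskBall ms 3 (2 ^ i) == 2 ^ ms.length - 1) &&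
      (((List.range ms.length).all fun i => maskBall ms 4 (2 ^ i) == 2 ^ ms.length - 1) &&
      !((List.range ms.length).all fun i => maskBall ms 3 (2 ^ i) == 2 ^ ms.length - 1))) =
        true := by
  decide +kernel

end Equiv.Perm

/-! ### The Coxeter group of type `B₃` -/

/-- One descent along a chain of point stabilizers: $S'$ fixes $p$ and every representative except
$1$ moves it, so a kernel element lies in the coset of $1$. -/
theorem mem_closure_of_map_eq_one {G α : Type*} [Group G] {S S' T : Set G} (h1 : 1 ∈ T)
    (hinv : ∀ s ∈ S, s⁻¹ = s)
    (hS : ∀ s ∈ S, ∀ g ∈ T, ∃ g' ∈ T, ∃ h ∈ Subgroup.closure S', s * g = g' * h)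
    (φ : G →* Perm α) (p : α) (hfix : ∀ s ∈ S', φ s p = p) (hT : ∀ g ∈ T, φ g p = p → g = 1)
    {w : G} (hw : w ∈ Subgroup.closure S) (hφ : φ w = 1) : w ∈ Subgroup.closure S' := by
  have hfix' : ∀ h ∈ Subgroup.closure S', φ h p = p := by
    intro h hh
    induction hh using Subgroup.closure_induction with
    | mem x hx => exact hfix x hx
    | one => simp
    | mul x y _ _ hx hy => rw [map_mul, mul_apply, hy, hx]
    | inv x _ hx => rw [map_inv, Perm.inv_eq_iff_eq, hx]
  obtain ⟨g, hg, h, hh, rfl⟩ := Subgroup.exists_eq_mul_of_mem_closure h1 hinv hS hw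
  have h2 := congrArg (fun σ : Perm α => σ p) hφ
  simp only [map_mul, mul_apply, hfix' h hh, one_apply] at h2
  rwa [hT g hg h2, one_mul]

/-- A group that is generated by elements satisfying the relations of type `B₃` embeds into the
group of signed permutations. -/
theorem eq_one_of_typeB_three_relations {W : Type*} [Group W] (φ : W →* Perm (Fin 6)) {x y z : W}
    (hφx : φ x = signedSimple 0) (hφy : φ y = signedSimple 1) (hφz : φ z = signedSimple 2)
    (hx : x * x = 1) (hy : y * y = 1) (hz : z * z = 1) (hxy : x * y * x = y * x * y)
    (hxz : x * z = z * x) (hyz : y * z * y * z = z * y * z * y)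
    {w : W} (hw : w ∈ Subgroup.closure {x, y, z}) (hφ : φ w = 1) : w = 1 := by
  -- The relations are restated with an arbitrary tail $u$ so that they apply inside
  -- right-associated words.
  have hx' : ∀ u, x * (x * u) = u := fun u => by rw [← mul_assoc, hx, one_mul]
  have hy' : ∀ u, y * (y * u) = u := fun u => by rw [← mul_assoc, hy, one_mul]
  have hz' : ∀ u, z * (z * u) = u := fun u => by rw [← mul_assoc, hz, one_mul]
  have hxy0 : x * (y * x) = y * (x * y) := by simpa only [mul_assoc] using hxy
  have hyz0 : y * (z * (y * z)) = z * (y * (z * y)) := by simpa only [mul_assoc] using hyz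
  have hxy' : ∀ u, x * (y * (x * u)) = y * (x * (y * u)) := fun u => by
    simpa only [mul_assoc] using congrArg (· * u) hxy
  have hxz' : ∀ u, x * (z * u) = z * (x * u) := fun u => by
    simpa only [mul_assoc] using congrArg (· * u) hxz
  have hyz' : ∀ u, y * (z * (y * (z * u))) = z * (y * (z * (y * u))) := fun u => by
    simpa only [mul_assoc] using congrArg (· * u) hyz
  have hxi := inv_eq_of_mul_eq_one_left hx
  have hyi := inv_eq_of_mul_eq_one_left hy
  have hzi := inv_eq_of_mul_eq_one_left hz
  -- The representatives carry the point $0$ to its six images; the next two stages use the orbits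
  -- of $1$ and $2$, with four and two points.
  have hw1 : w ∈ Subgroup.closure {y, z} := by
    have my : y ∈ Subgroup.closure {y, z} := Subgroup.subset_closure (by simp)
    have mz : z ∈ Subgroup.closure {y, z} := Subgroup.subset_closure (by simp)
    refine mem_closure_of_map_eq_one
      (T := {1, x, y * x, z * (y * x), y * (z * (y * x)), x * (y * (z * (y * x)))})
      (by simp) (by simp [hxi, hyi, hzi]) ?_ φ 0 ?_ ?_ hw hφ
    · simp only [Set.mem_insert_iff, Set.mem_singleton_iff, forall_eq_or_imp, forall_eq,
        exists_eq_or_imp, exists_eq_left]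
      refine ⟨⟨?_, ?_, ?_, ?_, ?_, ?_⟩, ⟨?_, ?_, ?_, ?_, ?_, ?_⟩, ?_, ?_, ?_, ?_, ?_, ?_⟩
      · exact .inr (.inl ⟨1, one_mem _, by simp⟩)
      · exact .inl ⟨1, one_mem _, by simp [hx]⟩
      · exact .inr (.inr (.inl ⟨y, my, by simp only [mul_assoc, hxy0]⟩))
      · exact .inr (.inr (.inr (.inl ⟨y, my, by simp only [mul_assoc, hxz', hxy0]⟩)))
      · exact .inr (.inr (.inr (.inr (.inr ⟨1, one_mem _, by simp⟩))))
      · exact .inr (.inr (.inr (.inr (.inl ⟨1, one_mem _, by simp [hx']⟩))))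
      · exact .inl ⟨y, my, by simp⟩
      · exact .inr (.inr (.inl ⟨1, one_mem _, by simp⟩))
      · exact .inr (.inl ⟨1, one_mem _, by simp [hy']⟩)
      · exact .inr (.inr (.inr (.inr (.inl ⟨1, one_mem _, by simp⟩))))
      · exact .inr (.inr (.inr (.inl ⟨1, one_mem _, by simp [hy']⟩)))
      · refine .inr (.inr (.inr (.inr (.inr ⟨y, my, ?_⟩))))
        simp only [mul_assoc]
        rw [← hxy0, ← hxy', ← hxz']
      · exact .inl ⟨z, mz, by simp⟩
      · exact .inr (.inl ⟨z, mz, hxz.symm⟩)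
      · exact .inr (.inr (.inr (.inl ⟨1, one_mem _, by simp⟩)))
      · exact .inr (.inr (.inl ⟨1, one_mem _, by simp [hz']⟩))
      · refine .inr (.inr (.inr (.inr (.inl ⟨z, mz, ?_⟩))))
        simp only [mul_assoc]
        rw [hxz, hyz']
      · refine .inr (.inr (.inr (.inr (.inr ⟨z, mz, ?_⟩))))
        simp only [mul_assoc]
        rw [hxz, hyz', hxz']
    · simp only [Set.mem_insert_iff, Set.mem_singleton_iff, forall_eq_or_imp, forall_eq, hφy, hφz]
      decide +kernel
    · simp only [Set.mem_insert_iff, Set.mem_singleton_iff, forall_eq_or_imp, forall_eq, map_mul,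
        hφx, hφy, hφz]
      refine ⟨fun _ => trivial, ?_, ?_, ?_, ?_, ?_⟩ <;> exact fun h => absurd h (by decide +kernel)
  have hw2 : w ∈ Subgroup.closure {z} := by
    have mz : z ∈ Subgroup.closure {z} := Subgroup.subset_closure (by simp)
    refine mem_closure_of_map_eq_one (T := {1, y, z * y, y * (z * y)})
      (by simp) (by simp [hyi, hzi]) ?_ φ 1 ?_ ?_ hw1 hφ
    · simp only [Set.mem_insert_iff, Set.mem_singleton_iff, forall_eq_or_imp, forall_eq,
        exists_eq_or_imp, exists_eq_left]
      refine ⟨⟨?_, ?_, ?_, ?_⟩, ?_, ?_, ?_, ?_⟩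
      · exact .inr (.inl ⟨1, one_mem _, by simp⟩)
      · exact .inl ⟨1, one_mem _, by simp [hy]⟩
      · exact .inr (.inr (.inr ⟨1, one_mem _, by simp⟩))
      · exact .inr (.inr (.inl ⟨1, one_mem _, by simp [hy']⟩))
      · exact .inl ⟨z, mz, by simp⟩
      · exact .inr (.inr (.inl ⟨1, one_mem _, by simp⟩))
      · exact .inr (.inl ⟨1, one_mem _, by simp [hz']⟩)
      · exact .inr (.inr (.inr ⟨z, mz, by simp only [mul_assoc, hyz0]⟩))
    · simp only [Set.mem_singleton_iff, forall_eq, hφz]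
      decide +kernel
    · simp only [Set.mem_insert_iff, Set.mem_singleton_iff, forall_eq_or_imp, forall_eq, map_mul,
        hφy, hφz]
      refine ⟨fun _ => trivial, ?_, ?_, ?_⟩ <;> exact fun h => absurd h (by decide +kernel)
  have hw3 : w ∈ Subgroup.closure ∅ := by
    refine mem_closure_of_map_eq_one (T := {1, z}) (by simp) (by simp [hzi]) ?_ φ 2 (by simp) ?_
      hw2 hφ
    · simp only [Set.mem_insert_iff, Set.mem_singleton_iff, forall_eq_or_imp, forall_eq,
        exists_eq_or_imp, exists_eq_left]
      exact ⟨.inr ⟨1, one_mem _, by simp⟩, .inl ⟨1, one_mem _, by simp [hz]⟩⟩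
    · simp only [Set.mem_insert_iff, Set.mem_singleton_iff, forall_eq_or_imp, forall_eq, hφz]
      exact ⟨fun _ => trivial, fun h => absurd h (by decide +kernel)⟩
  simpa using hw3

namespace CoxeterSystem

variable {B W : Type*} [Group W] {M : CoxeterMatrix B} {cs : CoxeterSystem M W}

theorem isLiftable_signedSimple {e : B ≃ Fin 3} (h : M.reindex e = CoxeterMatrix.B 3) :
    M.IsLiftable fun i => signedSimple (e i) := by
  intro i j
  have hM : M i j = CoxeterMatrix.B 3 (e i) (e j) := by
    rw [← h, CoxeterMatrix.reindex_apply]; simp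
  have key : ∀ i j : Fin 3, (signedSimple i * signedSimple j) ^ CoxeterMatrix.B 3 i j = 1 := by
    decide +kernel
  rw [hM]
  exact key (e i) (e j)

variable (cs) in
/-- A Coxeter group of type `B₃` is a group of signed permutations. -/
theorem exists_injective_signedSimple {e : B ≃ Fin 3} (h : M.reindex e = CoxeterMatrix.B 3) :
    ∃ φ : W →* Perm (Fin 6), Function.Injective φ ∧
      ∀ i, φ (cs.simple i) = signedSimple (e i) := by
  have hφ := cs.lift_apply_simple (isLiftable_signedSimple h)
  refine ⟨_, ?_, hφ⟩
  rw [injective_iff_map_eq_one]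
  intro w
  have hs := fun i => cs.simple_mul_simple_self (e.symm i)
  have hM : ∀ i j : Fin 3, (cs.simple (e.symm i) * cs.simple (e.symm j)) ^
      CoxeterMatrix.B 3 i j = 1 := by
    intro i j
    rw [← h, CoxeterMatrix.reindex_apply, simple_mul_simple_pow]
  have h01 := hM 0 1
  have h02 := hM 0 2
  have h12 := hM 1 2
  rw [show CoxeterMatrix.B 3 0 1 = 3 by decide +kernel] at h01
  rw [show CoxeterMatrix.B 3 0 2 = 2 by decide +kernel] at h02
  rw [show CoxeterMatrix.B 3 1 2 = 4 by decide +kernel] at h12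
  refine eq_one_of_typeB_three_relations (x := cs.simple (e.symm 0)) (y := cs.simple (e.symm 1))
    (z := cs.simple (e.symm 2)) _ ?_ ?_ ?_ (hs 0) (hs 1) (hs 2)
    (eq_mul_mul_of_mul_pow_three_eq_one (hs 0) (hs 1) h01)
    (mul_comm_of_mul_pow_two_eq_one (hs 0) (hs 2) h02) ?_ ?_
  · rw [hφ, e.apply_symm_apply]
  · rw [hφ, e.apply_symm_apply]
  · rw [hφ, e.apply_symm_apply]
  · have h4 : (cs.simple (e.symm 1) * cs.simple (e.symm 2) * cs.simple (e.symm 1) *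
        cs.simple (e.symm 2)) * (cs.simple (e.symm 1) * cs.simple (e.symm 2) *
        cs.simple (e.symm 1) * cs.simple (e.symm 2)) = 1 := by
      rw [← h12]; simp only [pow_succ, pow_zero, one_mul, mul_assoc]
    rw [mul_eq_one_iff_eq_inv] at h4
    rw [h4]
    simp [mul_assoc]
  · have : ({cs.simple (e.symm 0), cs.simple (e.symm 1), cs.simple (e.symm 2)} : Set W) =
        Set.range cs.simple := by
      ext t
      simp only [Set.mem_insert_iff, Set.mem_singleton_iff, Set.mem_range]
      constructor
      · rintro (rfl | rfl | rfl) <;> exact ⟨_, rfl⟩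
      · rintro ⟨i, rfl⟩
        obtain ⟨j, rfl⟩ := e.symm.surjective i
        fin_cases j <;> simp
    rw [this, subgroup_closure_range_simple]
    trivial

/-- The list contains the simple reflections and is closed under conjugation by them; conversely,
each entry is stored as an explicit conjugate. -/
theorem image_isReflection_eq_signedReflections {e : B ≃ Fin 3} {φ : W →* Perm (Fin 6)}
    (hφ : ∀ i, φ (cs.simple i) = signedSimple (e i)) :
    φ '' {t | cs.IsReflection t} = {t | t ∈ signedReflections} := by
  have hφ' : ∀ i, φ (cs.simple (e.symm i)) = signedSimple i := fun i => by
    rw [hφ, e.apply_symm_apply]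
  ext t
  constructor
  · rintro ⟨_, ⟨w, i, rfl⟩, rfl⟩
    change _ ∈ signedReflections
    induction w using cs.simple_induction_left with
    | one => simpa [hφ] using signedSimple_mem (e i)
    | mul_simple_left w j ih =>
      have := conj_signedSimple_mem (e j) _ ih
      rw [← hφ j, ← map_inv, ← map_mul, ← map_mul] at this
      convert this using 2
      group
  · intro ht
    obtain ⟨⟨l, i⟩, -, rfl⟩ := List.mem_map.1 ht
    refine ⟨_, ⟨(l.map fun j => cs.simple (e.symm j)).prod, e.symm i, rfl⟩, ?_⟩
    have : φ (l.map fun j => cs.simple (e.symm j)).prod = (l.map signedSimple).prod := by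
      rw [map_list_prod, List.map_map]
      congr 1
      exact List.map_congr_left fun j _ => hφ' j
    rw [map_mul, map_mul, map_inv, this, hφ']

/-- Cyclic rotation of a product is conjugation; together with the commutation of the two end
generators this connects all six orders. -/
theorem isConj_of_typeB_three {e : B ≃ Fin 3} (h : M.reindex e = CoxeterMatrix.B 3) {c : W}
    (hc : cs.IsCoxeterElement c) : IsConj c
      (cs.simple (e.symm 0) * (cs.simple (e.symm 1) * cs.simple (e.symm 2))) := by
  obtain ⟨l, hl, hmem, hlc⟩ := hc
  refine hlc.symm.trans ?_
  have h02 : (cs.simple (e.symm 0) * cs.simple (e.symm 2)) ^ CoxeterMatrix.B 3 0 2 = 1 := by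
    rw [← h, CoxeterMatrix.reindex_apply, simple_mul_simple_pow]
  rw [show CoxeterMatrix.B 3 0 2 = 2 by decide +kernel] at h02
  have hcomm := mul_comm_of_mul_pow_two_eq_one (cs.simple_mul_simple_self _)
    (cs.simple_mul_simple_self _) h02
  have hperm : (l.map e).Perm [0, 1, 2] := by
    rw [List.perm_ext_iff_of_nodup (hl.map e.injective) (by decide)]
    intro i
    simp only [List.mem_map, List.mem_cons, List.not_mem_nil, or_false]
    refine ⟨fun _ => ?_, fun _ => ⟨e.symm i, hmem _, e.apply_symm_apply i⟩⟩
    have h3 : ∀ i : Fin 3, i = 0 ∨ i = 1 ∨ i = 2 := by decide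
    exact h3 i
  have hmap : cs.wordProd l = ((l.map e).map fun j => cs.simple (e.symm j)).prod := by
    rw [wordProd, List.map_map]
    congr 1
    exact List.map_congr_left fun i _ => by simp
  rw [hmap]
  generalize l.map e = m at hperm
  replace hperm : m = [0, 1, 2] ∨ m = [1, 0, 2] ∨ m = [2, 1, 0] ∨ m = [1, 2, 0] ∨ m = [2, 0, 1] ∨
      m = [0, 2, 1] := by
    obtain ⟨i, j, k, rfl⟩ := List.length_eq_three.1 hperm.length_eq
    have key : ∀ i j k : Fin 3, [i, j, k].Nodup → [i, j, k] = [0, 1, 2] ∨ [i, j, k] = [1, 0, 2] ∨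
      [i, j, k] = [2, 1, 0] ∨ [i, j, k] = [1, 2, 0] ∨ [i, j, k] = [2, 0, 1] ∨
      [i, j, k] = [0, 2, 1] := by decide
    exact key i j k (hperm.nodup_iff.2 (by decide))
  set x := cs.simple (e.symm 0) with hx
  set y := cs.simple (e.symm 1) with hy
  set z := cs.simple (e.symm 2) with hz
  have h1 : IsConj (y * (z * x)) (x * (y * z)) := isConj_iff.2 ⟨x, by simp [mul_assoc]⟩
  have h2 : IsConj (z * (x * y)) (x * (y * z)) := isConj_iff.2 ⟨x * y, by simp [mul_assoc]⟩
  have h3 : IsConj (z * (y * x)) (y * (x * z)) := isConj_iff.2 ⟨z⁻¹, by simp [mul_assoc]⟩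
  rcases hperm with rfl | rfl | rfl | rfl | rfl | rfl <;>
    simp only [List.map_cons, List.map_nil, List.prod_cons, List.prod_nil, mul_one, ← hx, ← hy,
      ← hz]
  · exact IsConj.refl _
  · rwa [hcomm]
  · rw [hcomm] at h3
    exact h3.trans h1
  · exact h1
  · exact h2
  · rwa [← mul_assoc, hcomm, mul_assoc]

theorem hurwitzGraph_of_typeB_three [Fintype B] [Finite W] {c : W}
    (hc : cs.IsCoxeterElement c) (hM : M.HasType (CoxeterMatrix.B 3)) :
    (cs.hurwitzGraph c).radius ≤ 3 ∧ (cs.hurwitzGraph c).ediam = 4 := by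
  obtain ⟨e, he⟩ := hM
  obtain ⟨φ, hinj, hφ⟩ := cs.exists_injective_signedSimple he
  have hcard : Fintype.card B = 3 := by simpa using Fintype.card_congr e
  obtain ⟨g⟩ := cs.nonempty_factorizationGraph_iso_of_injective hc φ hinj
    (image_isReflection_eq_signedReflections hφ) (isConj_of_typeB_three he hc)
    (d := ([0, 1, 2].map signedSimple).prod) (by simp [hφ]) hcard
  obtain ⟨f, hf⟩ := exists_isMask nodup_signedReflections 3 ([0, 1, 2].map signedSimple).prod
  have h := evalMasks_signedReflections
  rw [evalMasks_eq, Bool.and_eq_true, Bool.and_eq_true, Bool.not_eq_true'] at h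
  rw [g.radius_eq, g.ediam_eq]
  refine ⟨hf.radius_le (k := 3) h.1, le_antisymm (hf.ediam_le (k := 4) h.2.1) ?_⟩
  have := Order.add_one_le_of_lt (hf.lt_ediam h.2.2)
  norm_num at this
  exact this

/-! ### Diameters in type $A$ and assembly of the theorem. -/

theorem exists_iso_swaps [Fintype B] [Finite W] {c : W} (hc : cs.IsCoxeterElement c) {n : ℕ}
    (hM : M.HasType (CoxeterMatrix.A n)) :
    Nonempty (factorizationGraph {t | t ∈ swaps (n + 1)} n
      (adjacentSwaps (fun i => Fin.ofNat (n + 1) i) n).prod ≃g cs.hurwitzGraph c) := by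
  obtain ⟨e, he⟩ := hM
  obtain ⟨φ, hφ⟩ := cs.exists_mulEquiv_perm he
  refine cs.nonempty_factorizationGraph_iso_hurwitzGraph hc φ (fun w => ?_)
    (isConj_adjacentSwaps hφ hc) (by simpa using Fintype.card_congr e)
  rw [isReflection_iff_isSwap hφ]
  exact mem_swaps.symm

theorem ediam_hurwitzGraph_of_typeA_three [Fintype B] [Finite W] {c : W}
    (hc : cs.IsCoxeterElement c) (hM : M.HasType (CoxeterMatrix.A 3)) :
    (cs.hurwitzGraph c).ediam ≤ 3 := by
  obtain ⟨g⟩ := exists_iso_swaps hc hM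
  obtain ⟨f, hf⟩ := exists_isMask nodup_swaps_four 3
    (adjacentSwaps (fun i => Fin.ofNat (3 + 1) i) 3).prod
  have h := evalMasks_swaps_four
  rw [evalMasks_eq] at h
  rw [g.ediam_eq]
  exact hf.ediam_le (k := 3) h

theorem ediam_hurwitzGraph_of_typeA_four [Fintype B] [Finite W] {c : W}
    (hc : cs.IsCoxeterElement c) (hM : M.HasType (CoxeterMatrix.A 4)) :
    (cs.hurwitzGraph c).ediam = 7 := by
  obtain ⟨g⟩ := exists_iso_swaps hc hM
  obtain ⟨f, hf⟩ := exists_isMask nodup_swaps_five 4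
    (adjacentSwaps (fun i => Fin.ofNat (4 + 1) i) 4).prod
  have h := evalMasks_swaps_five
  rw [evalMasks_eq, Bool.and_eq_true, Bool.not_eq_true'] at h
  rw [g.ediam_eq]
  refine le_antisymm (hf.ediam_le (k := 7) h.1) ?_
  have := Order.add_one_le_of_lt (hf.lt_ediam h.2)
  norm_num at this
  exact this

theorem choose_two_le_radius_hurwitzGraph [Fintype B] [Finite W] {c : W}
    (hc : cs.IsCoxeterElement c) :
    ((Fintype.card B).choose 2 : ℕ∞) ≤ (cs.hurwitzGraph c).radius := by
  classical
  rw [(cs.hurwitzGraphIso (cs.absLength_coxeterElement hc)).radius_eq, SimpleGraph.radius,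
    le_iInf_iff]
  intro l
  obtain ⟨m, hm⟩ := Factorization.exists_choose_two_le_edist hc rfl l
  exact hm.trans SimpleGraph.edist_le_eccent

end CoxeterSystem

theorem mainTheorem2 {B W : Type*} [Fintype B] [Group W] [Finite W] {M : CoxeterMatrix B}
    (cs : CoxeterSystem M W) (c : W) (hc : cs.IsCoxeterElement c) :
    (((Fintype.card B).choose 2 : ℕ) : ℕ∞) ≤ (cs.hurwitzGraph c).radius ∧
    (∀ n : ℕ, M.HasType (CoxeterMatrix.A n) →
      (cs.hurwitzGraph c).radius = ((n.choose 2 : ℕ) : ℕ∞)) ∧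
    (M.HasType (CoxeterMatrix.A 3) → (cs.hurwitzGraph c).ediam = 3) ∧
    (M.HasType (CoxeterMatrix.A 4) → (cs.hurwitzGraph c).ediam = 7) ∧
    (M.HasType (CoxeterMatrix.B 3) →
      (cs.hurwitzGraph c).radius = 3 ∧ (cs.hurwitzGraph c).ediam = 4) := by
  have hrad := CoxeterSystem.choose_two_le_radius_hurwitzGraph hc
  have hcard : ∀ {n : ℕ} {N : CoxeterMatrix (Fin n)}, M.HasType N → Fintype.card B = n := by
    rintro n N ⟨e, -⟩
    simpa using Fintype.card_congr e
  refine ⟨hrad, fun n hn => ?_, fun h => ?_, fun h => ?_, fun h => ?_⟩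
  · exact le_antisymm (CoxeterSystem.radius_hurwitzGraph_of_typeA hc hn) (hcard hn ▸ hrad)
  · refine le_antisymm (CoxeterSystem.ediam_hurwitzGraph_of_typeA_three hc h) ?_
    rw [hcard h] at hrad
    exact hrad.trans SimpleGraph.radius_le_ediam
  · exact CoxeterSystem.ediam_hurwitzGraph_of_typeA_four hc h
  · obtain ⟨h1, h2⟩ := CoxeterSystem.hurwitzGraph_of_typeB_three hc h
    rw [hcard h] at hrad
    exact ⟨le_antisymm h1 hrad, h2⟩
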